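/- Let $A$ be the automorphism $A(w,z)=(w+z,z)$ of $\mathbb{T}^4=\mathbb{C}^2/\mathbb{Z}[i]^2$ (in real coordinates $w=x_1+iy_1$, $z=x_2+iy_2$ it is the integer matrix with rows $(1,0,1,0),(0,1,0,1),(0,0,1,0),(0,0,0,1)$). Let $M=(\mathbb{T}^4\times[0,1])/((t,0)\sim(At,1))$ be its suspension, with the foliation $\mathcal{F}$ whose leaves are the images of the lines $\{t\}\times\mathbb{R}$. It is transversely holomorphic of complex codimension $2$, with the complex structure of $\mathbb{T}^4$. A smooth form $\omega$ on $M$ is basic if $i_X\omega=i_Xd\omega=0$ for every $X$ tangent to the leaves. Let $\Omega^{p,q}$ be the space of basic complex valued forms of type $(p,q)$, write $d=\partial+\bar\partial$ on basic forms, and let $$H^{p,q}_{\bar\partial}=\frac{\ker\bar\partial\cap\Omega^{p,q}}{\operatorname{im}\bar\partial\cap\Omega^{p,q}},\quad H^{p,q}_{BC}=\frac{\ker\partial\cap\ker\bar\partial\cap\Omega^{p,q}}{\operatorname{im}\partial\bar\partial\cap\Omega^{p,q}},\quad H^{p,q}_{A}=\frac{\ker\partial\bar\partial\cap\Omega^{p,q}}{(\operatorname{im}\partial+\operatorname{im}\bar\partial)\cap\Omega^{p,q}}$$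 be the basic Dolbeault, Bott--Chern and Aeppli cohomology. Let $\mathcal{C}=\mathcal{C}^\infty(\mathbb{T}^2,\mathbb{C})$ be the space of smooth complex functions $g(z)$ on $\mathbb{T}^2=\mathbb{C}/\mathbb{Z}[i]$, and put $\theta=dw\wedge d\bar z+d\bar w\wedge dz$. 1. For $0\le p,q\le 2$ these cohomologies are, as complex vector spaces, as follows (columns $p$, rows $q$). Dolbeault: $$\begin{array}{c|ccc} q=2&\mathcal{C}&\mathbb{C}&\mathcal{C}\\ q=1&\mathbb{C}&\mathbb{C}\oplus\mathbb{C}&\mathbb{C}\\ q=0&\mathbb{C}&\mathbb{C}&\mathbb{C}\\ \hline &p=0&p=1&p=2\end{array}$$ Bott--Chern: $$\begin{array}{c|ccc} q=2&\mathbb{C}&\mathcal{C}&\mathcal{C}\\ q=1&\mathbb{C}&\mathbb{C}\oplus\mathbb{C}&\mathcal{C}\\ q=0&\mathbb{C}&\mathbb{C}&\mathbb{C}\\ \hline &p=0&p=1&p=2\end{array}$$ Aeppli: $$\begin{array}{c|ccc} q=2&\mathcal{C}&\mathbb{C}&\mathcal{C}\\ q=1&\mathbb{C}&\mathcal{C}\oplus\mathbb{C}&\mathbb{C}\\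 q=0&\mathbb{C}&\mathbb{C}&\mathcal{C}\\ \hline &p=0&p=1&p=2\end{array}$$ More precisely, for $(p,q)\ne(1,1)$ the isomorphism sends a constant $g\in\mathbb{C}$, respectively a function $g\in\mathcal{C}$, to the class of $g\,\eta^{p,q}$, where $\eta^{0,0}=1$, $\eta^{1,0}=dz$, $\eta^{0,1}=d\bar z$, $\eta^{2,0}=dw\wedge dz$, $\eta^{0,2}=d\bar w\wedge d\bar z$, $\eta^{2,1}=dw\wedge dz\wedge d\bar z$, $\eta^{1,2}=dz\wedge d\bar w\wedge d\bar z$, $\eta^{2,2}=dw\wedge dz\wedge d\bar w\wedge d\bar z$. In bidegree $(1,1)$ it sends $(c,a)$ to the class of $c\,\theta+a\,dz\wedge d\bar z$, with $a\in\mathbb{C}$ and with $c\in\mathbb{C}$ for Dolbeault and Bott--Chern, $c\in\mathcal{C}$ for Aeppli cohomology. 2. In particular $H^{2,0}_A$, $H^{1,1}_A$, $H^{0,2}_A$ and $H^{2,2}_A$ are infinite dimensional, while $H^{1,1}_{\bar\partial}$ is finite dimensional. 3. There is no Riemannian metric on the transverse manifold $\mathbb{T}^4$ that is invariant under $A$,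 so $\mathcal{F}$ is not Riemannian. The duality between Bott--Chern and Aeppli cohomology fails: for $0\le p,q\le2$ with $(p,q)\notin\{(1,0),(0,1)\}$, the spaces $H^{p,q}_{BC}$ and $H^{2-p,2-q}_A$ are not isomorphic, not even over $\mathbb{R}$. Serre duality fails: for $(p,q)\in\{(0,0),(2,2),(2,0),(0,2)\}$ the space $H^{p,q}_{\bar\partial}$ is isomorphic neither to the dual of $H^{2-p,2-q}_{\bar\partial}$ nor to $H^{2-p,2-q}_{\bar\partial}$, not even over $\mathbb{R}$. -/

import Mathlib

noncomputable section

namespace TorusSuspension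

open scoped ContDiff

/-! ### The suspension and its forms

The suspension `M = (𝕋⁴ × [0,1]) / ((t,0) ∼ (A t,1))` is the quotient of `ℂ² × ℝ` by the group generated by
the translations of `ℂ²` by `ℤ[i]²` and by `(t, s) ↦ (A t, s + 1)`, with `A (w, z) = (w + z, z)`; in the real
coordinates `(x₁, y₁, x₂, y₂)`, `w = x₁ + i y₁`, `z = x₂ + i y₂`, this is the integer matrix
`[[1,0,1,0],[0,1,0,1],[0,0,1,0],[0,0,0,1]]`. The leaves are the images of the lines `{t} × ℝ`. A smooth form
on `M` is a smooth form on `ℂ² × ℝ` that is invariant under this group. -/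

/-- The universal cover `ℂ² × ℝ` of the suspension, with coordinates `((w, z), s)`. -/
abbrev Cover : Type := (ℂ × ℂ) × ℝ

/-- Complex valued differential `k`-forms on the cover. -/
abbrev KForm (k : ℕ) : Type := Cover → Cover [⋀^Fin k]→L[ℝ] ℂ

/-- Families of forms, one in each degree. -/
abbrev RawForm : Type := (k : ℕ) → KForm k

/-- The Gaussian integer `m + n i`. -/
def gauss (m n : ℤ) : ℂ := (m : ℂ) + (n : ℂ) * Complex.I

/-- The map `A (w, z) = (w + z, z)`. -/
def shear : (ℂ × ℂ) →L[ℝ] (ℂ × ℂ) :=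
  (ContinuousLinearMap.fst ℝ ℂ ℂ + ContinuousLinearMap.snd ℝ ℂ ℂ).prod (ContinuousLinearMap.snd ℝ ℂ ℂ)

/-- The linear part `(t, s) ↦ (A t, s)` of the monodromy. -/
def monoLin : Cover →L[ℝ] Cover := shear.prodMap (ContinuousLinearMap.id ℝ ℝ)

/-- The monodromy `(t, s) ↦ (A t, s + 1)`. -/
def mono (x : Cover) : Cover := (shear x.1, x.2 + 1)

/-- A basic `k`-form of the suspension foliation: a smooth form, invariant under the deck group, with
`i_X α = 0` and `i_X dα = 0` for every vector `X` tangent to the leaves. -/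
structure IsBasic {k : ℕ} (α : KForm k) : Prop where
  smooth : ContDiff ℝ ∞ α
  lattice : ∀ (m n m' n' : ℤ) (x : Cover), α (x + ((gauss m n, gauss m' n'), 0)) = α x
  mono : ∀ (x : Cover) (v : Fin k → Cover), α (mono x) (fun i => monoLin (v i)) = α x v
  contr : ∀ (x : Cover) (v : Fin k → Cover) (i : Fin k), (v i).1 = 0 → α x v = 0
  contr_d : ∀ (x : Cover) (v : Fin (k + 1) → Cover) (i : Fin (k + 1)),
    (v i).1 = 0 → extDeriv α x v = 0

lemma fderiv_eval {k : ℕ} {α : KForm k} (h : ContDiff ℝ ∞ α) (x u : Cover) (v : Fin k → Cover) :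
    fderiv ℝ α x u v = fderiv ℝ (fun y => α y v) x u := by
  have h1 : HasFDerivAt α (fderiv ℝ α x) x := (h.differentiable (by simp) x).hasFDerivAt
  have h2 := ((ContinuousAlternatingMap.apply ℝ Cover ℂ v).hasFDerivAt.comp x h1).fderiv
  have h3 : (fun y => α y v) = (ContinuousAlternatingMap.apply ℝ Cover ℂ v) ∘ α := rfl
  rw [h3, h2]; rfl

lemma fderiv_contr {k : ℕ} {α : KForm k} (h : ContDiff ℝ ∞ α)
    (hc : ∀ (x : Cover) (v : Fin k → Cover) (i : Fin k), (v i).1 = 0 → α x v = 0)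
    (x u : Cover) (v : Fin k → Cover) (i : Fin k) (hi : (v i).1 = 0) : fderiv ℝ α x u v = 0 := by
  rw [fderiv_eval h]
  have : (fun y => α y v) = fun _ => 0 := by funext y; exact hc y v i hi
  rw [this]; simp

/-- A basic form does not change along the leaves. -/
lemma IsBasic.fderiv_vert {k : ℕ} {α : KForm k} (h : IsBasic α) (x u : Cover) (hu : u.1 = 0) :
    fderiv ℝ α x u = 0 := by
  ext v
  have h0 := h.contr_d x (Fin.cons u v) 0 (by simpa using hu)
  rw [extDeriv, ContinuousAlternatingMap.alternatizeUncurryFin_apply, Fin.sum_univ_succ] at h0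
  rw [Finset.sum_eq_zero] at h0
  · simpa using h0
  · intro i _
    obtain ⟨n, rfl⟩ : ∃ n, k = n + 1 := ⟨k - 1, by have := i.2; omega⟩
    rw [fderiv_contr h.smooth h.contr _ _ _ 0, smul_zero]
    simpa [Fin.removeNth] using hu

lemma IsBasic.transl {k : ℕ} {α : KForm k} (h : IsBasic α) (x u : Cover) (hu : u.1 = 0) :
    α (x + u) = α x := by
  have hd : ∀ r : ℝ, HasDerivAt (fun r : ℝ => α (x + r • u)) 0 r := by
    intro r
    have h1 : HasFDerivAt α (fderiv ℝ α (x + r • u)) (x + r • u) :=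
      (h.smooth.differentiable (by simp) _).hasFDerivAt
    have h2 : HasDerivAt (fun r : ℝ => x + r • u) u r := by
      simpa using ((hasDerivAt_id r).smul_const u).const_add x
    have h3 := h1.comp_hasDerivAt r h2
    rwa [h.fderiv_vert _ _ hu] at h3
  have := is_const_of_deriv_eq_zero (fun r => (hd r).differentiableAt) (fun r => (hd r).deriv) 1 0
  simpa using this

lemma contr_d_of_transl {k : ℕ} {α : KForm k} (h : ContDiff ℝ ∞ α)
    (hc : ∀ (x : Cover) (v : Fin k → Cover) (i : Fin k), (v i).1 = 0 → α x v = 0)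
    (ht : ∀ x u : Cover, u.1 = 0 → α (x + u) = α x)
    (x : Cover) (v : Fin (k + 1) → Cover) (i : Fin (k + 1)) (hi : (v i).1 = 0) :
    extDeriv α x v = 0 := by
  rw [extDeriv, ContinuousAlternatingMap.alternatizeUncurryFin_apply]
  refine Finset.sum_eq_zero fun j _ => ?_
  by_cases hj : j = i
  · subst hj
    have h1 : HasFDerivAt α (fderiv ℝ α x) x := (h.differentiable (by simp) _).hasFDerivAt
    have h2 : HasDerivAt (fun r : ℝ => x + r • v j) (v j) 0 := by
      simpa using ((hasDerivAt_id (0 : ℝ)).smul_const (v j)).const_add x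
    have h3 := HasFDerivAt.comp_hasDerivAt (0 : ℝ) (by simpa using h1) h2
    have h4 : (α ∘ fun r : ℝ => x + r • v j) = fun _ => α x := by
      funext r
      exact ht x _ (by simp [hi])
    rw [h4] at h3
    rw [h3.unique (hasDerivAt_const _ _)]
    simp
  · obtain ⟨l, rfl⟩ := Fin.exists_succAbove_eq (Ne.symm hj)
    rw [fderiv_contr h hc _ _ _ l, smul_zero]
    simpa [Fin.removeNth] using hi

/-- The basic forms `Ω^•(M/𝓕, ℂ)`, all degrees together. -/
def basicForms : Submodule ℂ RawForm where
  carrier := {α | ∀ k, IsBasic (α k)}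
  add_mem' := by
    intro a b ha hb k
    refine ⟨(ha k).smooth.add (hb k).smooth, fun m n m' n' x => ?_, fun x v => ?_, fun x v i hi => ?_,
      fun x v i hi => ?_⟩
    · simp [(ha k).lattice, (hb k).lattice]
    · simp [(ha k).mono, (hb k).mono]
    · simp [(ha k).contr x v i hi, (hb k).contr x v i hi]
    · have := extDeriv_add ((ha k).smooth.differentiable (by simp) x)
        ((hb k).smooth.differentiable (by simp) x)
      rw [Pi.add_apply, this]
      simp [(ha k).contr_d x v i hi, (hb k).contr_d x v i hi]
  zero_mem' := by
    intro k
    refine ⟨contDiff_const, ?_, ?_, ?_, ?_⟩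
    · intros; rfl
    · intros; rfl
    · intros; rfl
    · refine contr_d_of_transl contDiff_const ?_ ?_
      · intros; rfl
      · intros; rfl
  smul_mem' := by
    intro c a ha k
    refine ⟨(ha k).smooth.const_smul c, fun m n m' n' x => ?_, fun x v => ?_, fun x v i hi => ?_, ?_⟩
    · simp [(ha k).lattice]
    · simp [(ha k).mono]
    · simp [(ha k).contr x v i hi]
    · refine contr_d_of_transl ((ha k).smooth.const_smul c) ?_ ?_
      · intro x v i hi
        simp [(ha k).contr x v i hi]
      · intro x u hu
        simp [(ha k).transl x u hu]

/-- Shortcut for instance search. -/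
instance basicFormsAddCommGroup : AddCommGroup basicForms := basicForms.addCommGroup

/-! ### The operators `∂` and `∂̄` -/

/-- The tangent vector `u` without its component along the leaf. -/
def hor : Cover →L[ℝ] Cover :=
  (ContinuousLinearMap.fst ℝ (ℂ × ℂ) ℝ).prod 0

/-- The transverse complex structure: multiplication by `i` of the transverse component of `u`. -/
def rot : Cover →L[ℝ] Cover :=
  (Complex.I • ContinuousLinearMap.fst ℝ (ℂ × ℂ) ℝ).prod 0

/-- For `ε = -i` this is `∂α = ∑ dζ_j ∧ ∂α/∂ζ_j` and for `ε = i` it is `∂̄α = ∑ dζ̄_j ∧ ∂α/∂ζ̄_j`, with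
`ζ = (w, z)`: the derivative `D α (u)` in the transverse direction `u` is replaced by its complex linear
part `(D α (u) - i D α (i u)) / 2`, respectively its antilinear part `(D α (u) + i D α (i u)) / 2`, and the
result is alternated as in the exterior derivative. -/
def wirtinger (ε : ℂ) {k : ℕ} (α : KForm k) : KForm (k + 1) := fun x =>
  ContinuousAlternatingMap.alternatizeUncurryFin
    ((1 / 2 : ℂ) • ((fderiv ℝ α x).comp hor + ε • (fderiv ℝ α x).comp rot))

lemma wirtinger_apply (ε : ℂ) {k : ℕ} (α : KForm k) (x : Cover) (v : Fin (k + 1) → Cover) :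
    wirtinger ε α x v = ∑ i : Fin (k + 1), (-1) ^ (i : ℕ) • ((1 / 2 : ℂ) *
      (fderiv ℝ α x (hor (v i)) (i.removeNth v) + ε * fderiv ℝ α x (rot (v i)) (i.removeNth v))) := by
  rw [wirtinger, ContinuousAlternatingMap.alternatizeUncurryFin_apply]
  rfl

lemma IsBasic.wirtinger {k : ℕ} {α : KForm k} (h : IsBasic α) (ε : ℂ) :
    IsBasic (wirtinger ε α) := by
  have hfd : ContDiff ℝ ∞ (fderiv ℝ α) := h.smooth.fderiv_right (by simp)
  have hs : ContDiff ℝ ∞ (TorusSuspension.wirtinger ε α) := by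
    have hL : ContDiff ℝ ∞ (fun L : Cover →L[ℝ] Cover [⋀^Fin k]→L[ℝ] ℂ =>
        ContinuousAlternatingMap.alternatizeUncurryFin L) :=
      IsBoundedLinearMap.contDiff (𝕜 := ℝ) (IsLinearMap.with_bound
        ⟨fun a b => ContinuousAlternatingMap.alternatizeUncurryFin_add a b,
          fun c a => ContinuousAlternatingMap.alternatizeUncurryFin_smul c a⟩ (k + 1)
        fun a => ContinuousAlternatingMap.norm_alternatizeUncurryFin_le a)
    refine hL.comp ?_
    exact ((hfd.clm_comp contDiff_const).add
      ((hfd.clm_comp contDiff_const).const_smul ε)).const_smul (1 / 2 : ℂ)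
  have htr : ∀ u : Cover, (∀ x, α (x + u) = α x) →
      ∀ x, TorusSuspension.wirtinger ε α (x + u) = TorusSuspension.wirtinger ε α x := by
    intro u hu x
    have : fderiv ℝ α (x + u) = fderiv ℝ α x := by
      rw [← fderiv_comp_add_right]
      congr 1
      funext y
      exact hu y
    simp only [TorusSuspension.wirtinger, this]
  have hc : ∀ (x : Cover) (v : Fin (k + 1) → Cover) (i : Fin (k + 1)), (v i).1 = 0 →
      TorusSuspension.wirtinger ε α x v = 0 := by
    intro x v i hi
    rw [wirtinger_apply]
    refine Finset.sum_eq_zero fun j _ => ?_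
    by_cases hj : j = i
    · subst hj
      have h1 : hor (v j) = 0 := by ext <;> simp [hor, hi]
      have h2 : rot (v j) = 0 := by ext <;> simp [rot, hi]
      simp [h1, h2]
    · obtain ⟨l, rfl⟩ := Fin.exists_succAbove_eq (Ne.symm hj)
      rw [fderiv_contr h.smooth h.contr _ _ _ l, fderiv_contr h.smooth h.contr _ _ _ l]
      · simp
      · simpa [Fin.removeNth] using hi
      · simpa [Fin.removeNth] using hi
  refine ⟨hs, fun m n m' n' x => htr _ (h.lattice m n m' n') x, fun x v => ?_, hc,
    contr_d_of_transl hs hc fun x u hu => htr u (fun y => h.transl y u hu) x⟩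
  have key : ∀ (u : Cover) (v : Fin k → Cover),
      fderiv ℝ α (TorusSuspension.mono x) (monoLin u) (fun i => monoLin (v i)) =
        fderiv ℝ α x u v := by
    intro u v
    rw [fderiv_eval h.smooth, fderiv_eval h.smooth]
    have h1 : DifferentiableAt ℝ (fun y => α y fun i => monoLin (v i)) (TorusSuspension.mono x) :=
      (ContinuousAlternatingMap.apply ℝ Cover ℂ
        (fun i => monoLin (v i))).differentiableAt.comp _ (h.smooth.differentiable (by simp) _)
    have h2 : HasFDerivAt TorusSuspension.mono monoLin x := by
      have := monoLin.hasFDerivAt (x := x) |>.add_const ((0, 1) : Cover)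
      refine this.congr_of_eventuallyEq (Filter.Eventually.of_forall fun y => ?_)
      ext <;> simp [TorusSuspension.mono, monoLin]
    have h3 := (h1.hasFDerivAt.comp x h2).fderiv
    have h4 : (fun y => α y v) =
        (fun y => α y fun i => monoLin (v i)) ∘ TorusSuspension.mono := by
      funext y
      exact (h.mono y v).symm
    rw [h4, h3]
    rfl
  have e1 : ∀ u : Cover, hor (monoLin u) = monoLin (hor u) := fun u => by
    ext <;> simp [hor, monoLin, shear]
  have e2 : ∀ u : Cover, rot (monoLin u) = monoLin (rot u) := fun u => by
    ext <;> simp [rot, monoLin, shear, mul_add]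
  rw [wirtinger_apply, wirtinger_apply]
  refine Finset.sum_congr rfl fun i _ => ?_
  have e3 : i.removeNth (fun j => monoLin (v j)) = fun j => monoLin (i.removeNth v j) := rfl
  rw [e1, e2, e3, key, key]

lemma wirtinger_add (ε : ℂ) {k : ℕ} {a b : KForm k} (ha : IsBasic a) (hb : IsBasic b) :
    wirtinger ε (a + b) = wirtinger ε a + wirtinger ε b := by
  funext x
  ext v
  have := fderiv_add (ha.smooth.differentiable (by simp) x) (hb.smooth.differentiable (by simp) x)
  simp only [Pi.add_apply, ContinuousAlternatingMap.add_apply, wirtinger_apply, this,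
    add_apply, ← Finset.sum_add_distrib]
  refine Finset.sum_congr rfl fun i _ => ?_
  rw [← smul_add]
  congr 1
  ring

lemma wirtinger_smul (ε c : ℂ) {k : ℕ} {a : KForm k} (ha : IsBasic a) :
    wirtinger ε (c • a) = c • wirtinger ε a := by
  funext x
  ext v
  have := fderiv_const_smul (ha.smooth.differentiable (by simp) x) c
  simp only [Pi.smul_apply, ContinuousAlternatingMap.smul_apply, wirtinger_apply, this,
    smul_apply, Finset.smul_sum]
  refine Finset.sum_congr rfl fun i _ => ?_
  rw [smul_comm c]
  congr 1
  simp only [smul_eq_mul]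
  ring

/-- `wirtinger`, on all degrees together: it raises the degree by one. -/
def wirtingerRaw (ε : ℂ) (α : RawForm) : RawForm
  | 0 => 0
  | k + 1 => wirtinger ε (α k)

/-- `wirtinger` as an endomorphism of the space of basic forms. -/
def wirtingerBasic (ε : ℂ) : basicForms →ₗ[ℂ] basicForms where
  toFun α := ⟨wirtingerRaw ε α, by
    rintro (_ | k)
    · exact basicForms.zero_mem 0
    · exact (α.2 k).wirtinger ε⟩
  map_add' a b := by
    ext1
    funext k
    rcases k with _ | k
    · exact (add_zero (0 : KForm 0)).symm
    · exact wirtinger_add ε (a.2 k) (b.2 k)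
  map_smul' c a := by
    ext1
    funext k
    rcases k with _ | k
    · exact (smul_zero (A := KForm 0) c).symm
    · exact wirtinger_smul ε c (a.2 k)

/-- `∂` on basic forms. -/
def del : basicForms →ₗ[ℂ] basicForms := wirtingerBasic (-Complex.I)

/-- `∂̄` on basic forms. -/
def delBar : basicForms →ₗ[ℂ] basicForms := wirtingerBasic Complex.I

/-- On basic forms `d = ∂ + ∂̄`. -/
theorem extDeriv_eq_del_add_delBar (α : basicForms) (k : ℕ) :
    extDeriv (α.1 k) = (del α).1 (k + 1) + (delBar α).1 (k + 1) := by
  funext x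
  ext v
  have h : ∀ u, fderiv ℝ (α.1 k) x u = fderiv ℝ (α.1 k) x (hor u) := by
    intro u
    rw [← sub_eq_zero, ← map_sub]
    exact (α.2 k).fderiv_vert _ _ (by simp [hor])
  have e : ((del α).1 (k + 1) + (delBar α).1 (k + 1)) x v =
      wirtinger (-Complex.I) (α.1 k) x v + wirtinger Complex.I (α.1 k) x v := rfl
  rw [e, wirtinger_apply, wirtinger_apply, extDeriv,
    ContinuousAlternatingMap.alternatizeUncurryFin_apply, ← Finset.sum_add_distrib]
  refine Finset.sum_congr rfl fun i _ => ?_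
  rw [← smul_add, h]
  congr 1
  ring

/-! ### Bidegrees and cohomology -/

/-- The basic forms `Ω^{p,q}(M/𝓕, ℂ)` of type `(p,q)` for the transverse complex structure: the forms of
degree `p + q` that are multiplied by `c^p c̄^q` when their transverse arguments are multiplied by `c`. -/
def bidegree (p q : ℕ) : Submodule ℂ basicForms where
  carrier := {α | (∀ k, k ≠ p + q → α.1 k = 0) ∧
    ∀ (k : ℕ) (x : Cover) (c : ℂ) (v : Fin k → Cover),
      α.1 k x (fun i => (c • (v i).1, (v i).2)) = c ^ p * (starRingEnd ℂ c) ^ q * α.1 k x v}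
  add_mem' := by
    rintro a b ⟨ha, ha'⟩ ⟨hb, hb'⟩
    refine ⟨fun k hk => ?_, fun k x c v => ?_⟩
    · simp [ha k hk, hb k hk]
    · simp [ha' k x c v, hb' k x c v, mul_add]
  zero_mem' := ⟨fun k _ => rfl, fun k x c v => by simp⟩
  smul_mem' := by
    rintro r a ⟨ha, ha'⟩
    refine ⟨fun k hk => ?_, fun k x c v => ?_⟩
    · simp [ha k hk]
    · simp [ha' k x c v]
      ring

/-- The quotient `K / (I ∩ K)` of two spaces of basic forms. -/
abbrev QuotBy (K I : Submodule ℂ basicForms) : Type := K ⧸ I.submoduleOf K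

/-- `ker ∂̄ ∩ Ω^{p,q}`. -/
def dolbeaultZ (p q : ℕ) : Submodule ℂ basicForms := LinearMap.ker delBar ⊓ bidegree p q

/-- `im ∂̄ ∩ Ω^{p,q}`. -/
def dolbeaultB (p q : ℕ) : Submodule ℂ basicForms := LinearMap.range delBar ⊓ bidegree p q

/-- Basic Dolbeault cohomology `H^{p,q}_∂̄(M/𝓕)`. -/
abbrev Dolbeault (p q : ℕ) : Type := QuotBy (dolbeaultZ p q) (dolbeaultB p q)

/-- `ker ∂ ∩ ker ∂̄ ∩ Ω^{p,q}`. -/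
def bottChernZ (p q : ℕ) : Submodule ℂ basicForms :=
  LinearMap.ker del ⊓ LinearMap.ker delBar ⊓ bidegree p q

/-- `im ∂∂̄ ∩ Ω^{p,q}`. -/
def bottChernB (p q : ℕ) : Submodule ℂ basicForms := LinearMap.range (del ∘ₗ delBar) ⊓ bidegree p q

/-- Basic Bott-Chern cohomology `H^{p,q}_BC(M/𝓕)`. -/
abbrev BottChern (p q : ℕ) : Type := QuotBy (bottChernZ p q) (bottChernB p q)

/-- `ker ∂∂̄ ∩ Ω^{p,q}`. -/
def aeppliZ (p q : ℕ) : Submodule ℂ basicForms := LinearMap.ker (del ∘ₗ delBar) ⊓ bidegree p q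

/-- `(im ∂ + im ∂̄) ∩ Ω^{p,q}`. -/
def aeppliB (p q : ℕ) : Submodule ℂ basicForms :=
  (LinearMap.range del ⊔ LinearMap.range delBar) ⊓ bidegree p q

/-- Basic Aeppli cohomology `H^{p,q}_A(M/𝓕)`. -/
abbrev Aeppli (p q : ℕ) : Type := QuotBy (aeppliZ p q) (aeppliB p q)

/-! ### The entries of the tables -/

/-- `C^∞(𝕋², ℂ)`: the real-smooth functions of `z ∈ ℂ` that are periodic with respect to `ℤ[i]`. -/
def SmoothT2 : Submodule ℂ (ℂ → ℂ) where
  carrier := {g | ContDiff ℝ ∞ g ∧ ∀ (m n : ℤ) (z : ℂ), g (z + gauss m n) = g z}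
  add_mem' := by
    rintro a b ⟨ha, ha'⟩ ⟨hb, hb'⟩
    exact ⟨ha.add hb, fun m n z => by simp [ha', hb']⟩
  zero_mem' := ⟨contDiff_const, fun _ _ _ => rfl⟩
  smul_mem' := by
    rintro c a ⟨ha, ha'⟩
    exact ⟨ha.const_smul c, fun m n z => by simp [ha']⟩

/-- The 1-form `dw`. -/
def dw : Cover →L[ℝ] ℂ :=
  (ContinuousLinearMap.fst ℝ ℂ ℂ).comp (ContinuousLinearMap.fst ℝ (ℂ × ℂ) ℝ)

/-- The 1-form `dz`. -/
def dz : Cover →L[ℝ] ℂ :=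
  (ContinuousLinearMap.snd ℝ ℂ ℂ).comp (ContinuousLinearMap.fst ℝ (ℂ × ℂ) ℝ)

/-- The 1-form `dw̄`. -/
def dwBar : Cover →L[ℝ] ℂ := (Complex.conjCLE : ℂ →L[ℝ] ℂ).comp dw

/-- The 1-form `dz̄`. -/
def dzBar : Cover →L[ℝ] ℂ := (Complex.conjCLE : ℂ →L[ℝ] ℂ).comp dz

/-- The wedge product `η₁ ∧ ⋯ ∧ η_k` of 1-forms. -/
def wedge {k : ℕ} (η : Fin k → Cover →L[ℝ] ℂ) : Cover [⋀^Fin k]→L[ℝ] ℂ :=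
  ContinuousMultilinearMap.alternatization
    ((ContinuousMultilinearMap.mkPiAlgebra ℝ (Fin k) ℂ).compContinuousLinearMap η)

theorem wedge_apply {k : ℕ} (η : Fin k → Cover →L[ℝ] ℂ) (v : Fin k → Cover) :
    wedge η v = Matrix.det (Matrix.of fun i j => η i (v j)) := by
  rw [wedge, ContinuousMultilinearMap.alternatization_apply_apply, ← Matrix.det_transpose,
    Matrix.det_apply]
  rfl

/-- The form `g(z) η₁ ∧ ⋯ ∧ η_k` (and zero in the degrees other than `k`). -/
def term {k : ℕ} (g : ℂ → ℂ) (η : Fin k → Cover →L[ℝ] ℂ) : RawForm :=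
  Pi.single k fun x => g x.1.2 • wedge η

/-- The form `g(z) (dw ∧ dz̄ + dw̄ ∧ dz)`. -/
def mixed (g : ℂ → ℂ) : RawForm := term g ![dw, dzBar] + term g ![dwBar, dz]

/-- The map that sends `x` to the class of the form `θ x` is a well defined linear isomorphism of `X` onto
the cohomology space `K / (I ∩ K)`. -/
def IsoByClasses {X : Type} [AddCommGroup X] [Module ℂ X] (K I : Submodule ℂ basicForms)
    (θ : X → RawForm) : Prop :=
  ∃ e : X ≃ₗ[ℂ] QuotBy K I, ∀ x : X, ∃ α : K, (α : basicForms).1 = θ x ∧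
    e x = (I.submoduleOf K).mkQ α

/-- `x ↦ [θ x]` is a linear isomorphism of `X` onto `H^{p,q}_∂̄(M/𝓕)`. -/
def DolbeaultVia {X : Type} [AddCommGroup X] [Module ℂ X] (p q : ℕ) (θ : X → RawForm) : Prop :=
  IsoByClasses (dolbeaultZ p q) (dolbeaultB p q) θ

/-- `x ↦ [θ x]` is a linear isomorphism of `X` onto `H^{p,q}_BC(M/𝓕)`. -/
def BottChernVia {X : Type} [AddCommGroup X] [Module ℂ X] (p q : ℕ) (θ : X → RawForm) : Prop :=
  IsoByClasses (bottChernZ p q) (bottChernB p q) θ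

/-- `x ↦ [θ x]` is a linear isomorphism of `X` onto `H^{p,q}_A(M/𝓕)`. -/
def AeppliVia {X : Type} [AddCommGroup X] [Module ℂ X] (p q : ℕ) (θ : X → RawForm) : Prop :=
  IsoByClasses (aeppliZ p q) (aeppliB p q) θ

/-- A Riemannian metric on the transverse torus `𝕋⁴` that is invariant under `A`, that is, under the
holonomy pseudogroup. -/
structure IsTransverseMetric (g : ℂ × ℂ → (ℂ × ℂ) →L[ℝ] (ℂ × ℂ) →L[ℝ] ℝ) : Prop where
  smooth : ContDiff ℝ ∞ g
  symm : ∀ t u v, g t u v = g t v u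
  pos : ∀ t u, u ≠ 0 → 0 < g t u u
  lattice : ∀ (m n m' n' : ℤ) (t : ℂ × ℂ), g (t + (gauss m n, gauss m' n')) = g t
  invariant : ∀ t u v, g (shear t) (shear u) (shear v) = g t u v

end TorusSuspension

end

open TorusSuspension

/-!
The coefficients of a basic form are bounded, being functions on a compact space, but under the
powers of the shear they grow polynomially unless the form is annihilated by the nilpotent part `N`
of the monodromy. Then they are invariant under the monodromy, which translates `w` by multiples of
`z` modulo `ℤ[i]`; for `z` in a dense set these reach any prescribed point, so the coefficients
depend on `z` alone. Hence the basic forms are the free module over the smooth functions `g(z)` on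
the constant forms killed by `N`, which are spanned by `1`, `dz`, `dz̄`, `dw ∧ dz`, `θ`, `dz ∧ dz̄`,
`dw̄ ∧ dz̄`, `dw ∧ dz ∧ dz̄`, `dz ∧ dw̄ ∧ dz̄` and `dw ∧ dz ∧ dw̄ ∧ dz̄`.

In these coordinates `∂` and `∂̄` are, up to sign, `∂/∂z` and `∂/∂z̄` from one generator to another.
By Fourier series the kernel of either operator on the torus consists of the constants and its image
of the functions of mean zero. Every kernel and image in the three cohomologies is therefore given
generator by generator by `0`, the constants, the functions of mean zero or all functions, and every
entry of the tables is a quotient of two of these.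
-/

noncomputable section
namespace TorusSuspension
open MeasureTheory Filter Topology
open scoped ContDiff

/-! ### Fourier series on `ℂ / ℤ[i]` -/

/-- The projection of `ℂ` onto the torus `ℂ / ℤ[i]`, in the real coordinates `(x, y)` that make the
Fourier theory of `UnitAddTorus` applicable to `SmoothT2`. -/
def torusProj : ℂ →+ UnitAddTorus (Fin 2) where
  toFun z := ![(z.re : UnitAddCircle), (z.im : UnitAddCircle)]
  map_zero' := by ext i; fin_cases i <;> simp
  map_add' z w := by ext i; fin_cases i <;> simp

lemma torusProj_apply (z : ℂ) :
    torusProj z = ![(z.re : UnitAddCircle), (z.im : UnitAddCircle)] := rfl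

lemma continuous_torusProj : Continuous torusProj := by
  refine continuous_pi fun i => ?_
  fin_cases i
  · exact (AddCircle.continuous_mk' 1).comp Complex.continuous_re
  · exact (AddCircle.continuous_mk' 1).comp Complex.continuous_im

lemma torusProj_surjective : Function.Surjective torusProj := by
  intro t
  obtain ⟨a, ha⟩ := QuotientAddGroup.mk_surjective (t 0)
  obtain ⟨b, hb⟩ := QuotientAddGroup.mk_surjective (t 1)
  refine ⟨⟨a, b⟩, ?_⟩
  ext i
  fin_cases i
  · exact ha
  · exact hb

lemma isOpenMap_torusProj : IsOpenMap torusProj := by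
  have hcoe : IsOpenMap (Pi.map fun _ : Fin 2 => ((↑) : ℝ → UnitAddCircle)) :=
    IsOpenMap.piMap (fun _ => QuotientAddGroup.isOpenMap_coe)
      (Eventually.of_forall fun _ => QuotientAddGroup.mk_surjective)
  convert hcoe.comp
    (Complex.equivRealProdCLM.toHomeomorph.trans (Homeomorph.finTwoArrow (X := ℝ)).symm).isOpenMap
    using 1
  funext z i
  fin_cases i <;> rfl

lemma isQuotientMap_torusProj : IsQuotientMap torusProj :=
  isOpenMap_torusProj.isQuotientMap continuous_torusProj torusProj_surjective

@[simp] lemma torusProj_gauss (m n : ℤ) : torusProj (gauss m n) = 0 := by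
  ext i
  fin_cases i <;> simp [torusProj_apply, gauss]

lemma exists_gauss_of_torusProj_eq {z w : ℂ} (h : torusProj z = torusProj w) :
    ∃ m n : ℤ, z = w + gauss m n := by
  have hsub : torusProj (z - w) = 0 := by rw [map_sub, h, sub_self]
  obtain ⟨m, hm⟩ := (AddCircle.coe_eq_zero_iff _).1 (congrFun hsub 0)
  obtain ⟨n, hn⟩ := (AddCircle.coe_eq_zero_iff _).1 (congrFun hsub 1)
  refine ⟨m, n, ?_⟩
  rw [← sub_eq_iff_eq_add']
  apply Complex.ext
  · simpa [gauss] using hm.symm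
  · simpa [gauss] using hn.symm

/-- The function on the torus induced by a `ℤ[i]`-periodic function on `ℂ`. For other functions the
choice of representatives makes it meaningless. -/
def torusLift (g : ℂ → ℂ) (t : UnitAddTorus (Fin 2)) : ℂ :=
  g (Function.surjInv torusProj_surjective t)

lemma torusLift_torusProj (g : SmoothT2) (z : ℂ) : torusLift g.1 (torusProj z) = g.1 z := by
  obtain ⟨m, n, h⟩ := exists_gauss_of_torusProj_eq
    (Function.surjInv_eq torusProj_surjective (torusProj z))
  rw [torusLift, h, g.2.2]

lemma continuous_torusLift (g : SmoothT2) : Continuous (torusLift g.1) := by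
  have hcomp : torusLift g.1 ∘ torusProj = g.1 := funext (torusLift_torusProj g)
  rw [isQuotientMap_torusProj.continuous_iff, hcomp]
  exact g.2.1.continuous

lemma exists_norm_le_smoothT2 (g : SmoothT2) : ∃ C, ∀ z, ‖g.1 z‖ ≤ C := by
  obtain ⟨C, hC⟩ := (isCompact_range (continuous_torusLift g)).isBounded.exists_norm_le
  exact ⟨C, fun z => torusLift_torusProj g z ▸ hC _ ⟨_, rfl⟩⟩

/-- The derivative of periodic functions in the direction `v`. -/
def dirDeriv (v : ℂ) : SmoothT2 →ₗ[ℂ] SmoothT2 where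
  toFun g := ⟨fun z => fderiv ℝ g.1 z v,
    (g.2.1.fderiv_right (by simp)).clm_apply contDiff_const, fun m n z => by
      change fderiv ℝ g.1 (z + gauss m n) v = fderiv ℝ g.1 z v
      rw [← fderiv_comp_add_right]
      simp only [g.2.2]⟩
  map_add' a b := by
    ext z
    exact congrArg (· v) (fderiv_add (a.2.1.differentiable (by simp) z)
      (b.2.1.differentiable (by simp) z))
  map_smul' c a := by
    ext z
    exact congrArg (· v) (fderiv_const_smul (a.2.1.differentiable (by simp) z) c)

lemma hasDerivAt_torusLift_add (g : SmoothT2) (v : ℂ) (t : UnitAddTorus (Fin 2)) (s : ℝ) :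
    HasDerivAt (fun s : ℝ => torusLift g.1 (t + torusProj (s • v)))
      (torusLift (dirDeriv v g).1 (t + torusProj (s • v))) s := by
  obtain ⟨z, rfl⟩ := torusProj_surjective t
  simp only [← map_add, torusLift_torusProj]
  have hline : HasDerivAt (fun s : ℝ => z + s • v) v s := by
    simpa using ((hasDerivAt_id s).smul_const v).const_add z
  exact ((g.2.1.differentiable (by simp) (z + s • v)).hasFDerivAt).comp_hasDerivAt s hline

/-- The logarithmic derivative of the character of index `n` of the torus. -/
def freq (n : Fin 2 → ℤ) : ℂ →L[ℝ] ℂ :=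
  (2 * Real.pi * Complex.I : ℂ) • (((n 0 : ℤ) : ℂ) • Complex.ofRealCLM.comp Complex.reCLM +
    ((n 1 : ℤ) : ℂ) • Complex.ofRealCLM.comp Complex.imCLM)

lemma freq_apply (n : Fin 2 → ℤ) (z : ℂ) :
    freq n z = 2 * Real.pi * Complex.I * (n 0 * z.re + n 1 * z.im) := rfl

/-- The character `exp (2 π i (n₀ x + n₁ y))` of the torus, as a function of `z = x + i y`. -/
def torusChar (n : Fin 2 → ℤ) (z : ℂ) : ℂ := Complex.exp (freq n z)

lemma torusChar_add (n : Fin 2 → ℤ) (z w : ℂ) :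
    torusChar n (z + w) = torusChar n z * torusChar n w := by
  rw [torusChar, map_add, Complex.exp_add]; rfl

@[simp] lemma torusChar_zero (n : Fin 2 → ℤ) : torusChar n 0 = 1 := by simp [torusChar]

lemma torusChar_neg_mul_self (n : Fin 2 → ℤ) (z : ℂ) : torusChar (-n) z * torusChar n z = 1 := by
  have h : freq (-n) z + freq n z = 0 := by
    simp only [freq_apply, Pi.neg_apply, Int.cast_neg]; ring
  rw [torusChar, torusChar, ← Complex.exp_add, h, Complex.exp_zero]

lemma norm_torusChar (n : Fin 2 → ℤ) (z : ℂ) : ‖torusChar n z‖ = 1 := by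
  rw [torusChar, Complex.norm_exp, freq_apply]
  simp

lemma mFourier_torusProj (n : Fin 2 → ℤ) (z : ℂ) :
    UnitAddTorus.mFourier n (torusProj z) = torusChar n z := by
  simp only [UnitAddTorus.mFourier, ContinuousMap.coe_mk, Fin.prod_univ_two, torusProj_apply,
    Matrix.cons_val_zero, Matrix.cons_val_one, fourier_coe_apply, torusChar, freq_apply,
    ← Complex.exp_add]
  congr 1
  push_cast
  ring

lemma torusChar_add_gauss (n : Fin 2 → ℤ) (a b : ℤ) (z : ℂ) :
    torusChar n (z + gauss a b) = torusChar n z := by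
  rw [← mFourier_torusProj, ← mFourier_torusProj, map_add, torusProj_gauss, add_zero]

lemma hasFDerivAt_torusChar (n : Fin 2 → ℤ) (z : ℂ) :
    HasFDerivAt (torusChar n) (torusChar n z • freq n) z :=
  (freq n).hasFDerivAt.cexp

lemma hasDerivAt_torusChar_smul (n : Fin 2 → ℤ) (v : ℂ) :
    HasDerivAt (fun s : ℝ => torusChar n (s • v)) (freq n v) 0 := by
  have hline : HasDerivAt (fun s : ℝ => s • v) v 0 := by
    simpa using (hasDerivAt_id (0 : ℝ)).smul_const v
  simpa [Function.comp_def] using (hasFDerivAt_torusChar n ((0 : ℝ) • v)).comp_hasDerivAt 0 hline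

-- `UnitAddTorus.mFourierCoeff` integrates against the Haar probability measure, an instance that
-- Mathlib only declares locally.
local instance : MeasureSpace UnitAddCircle := ⟨AddCircle.haarAddCircle⟩

local instance : Measure.IsAddHaarMeasure (volume : Measure UnitAddCircle) :=
  inferInstanceAs (Measure.IsAddHaarMeasure AddCircle.haarAddCircle)

local instance : IsProbabilityMeasure (volume : Measure UnitAddCircle) :=
  inferInstanceAs (IsProbabilityMeasure AddCircle.haarAddCircle)

lemma integrable_mFourier_smul_torusLift (n : Fin 2 → ℤ) (g : SmoothT2) :
    Integrable (fun t => UnitAddTorus.mFourier n t • torusLift g.1 t) :=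
  ((UnitAddTorus.mFourier n).continuous.smul
    (continuous_torusLift g)).integrable_of_hasCompactSupport (HasCompactSupport.of_compactSpace _)

/-- The Fourier coefficient of index `n` of a smooth function on the torus. -/
def fourierCoef (n : Fin 2 → ℤ) : SmoothT2 →ₗ[ℂ] ℂ where
  toFun g := UnitAddTorus.mFourierCoeff (torusLift g.1) n
  map_add' a b := by
    rw [UnitAddTorus.mFourierCoeff, UnitAddTorus.mFourierCoeff, UnitAddTorus.mFourierCoeff,
      ← integral_add (integrable_mFourier_smul_torusLift _ a)
        (integrable_mFourier_smul_torusLift _ b)]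
    exact congrArg _ (funext fun t => smul_add _ _ _)
  map_smul' c a := by
    rw [UnitAddTorus.mFourierCoeff, UnitAddTorus.mFourierCoeff, RingHom.id_apply, ← integral_smul]
    exact congrArg _ (funext fun t => smul_comm _ c _)

lemma fourierCoef_apply (n : Fin 2 → ℤ) (g : SmoothT2) :
    fourierCoef n g = ∫ t, UnitAddTorus.mFourier (-n) t • torusLift g.1 t := rfl

lemma norm_mFourier_smul (n : Fin 2 → ℤ) (t : UnitAddTorus (Fin 2)) (c : ℂ) :
    ‖UnitAddTorus.mFourier n t • c‖ = ‖c‖ := by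
  obtain ⟨z, rfl⟩ := torusProj_surjective t
  rw [norm_smul, mFourier_torusProj, norm_torusChar, one_mul]

lemma norm_torusLift_le {g : SmoothT2} {C : ℝ} (h : ∀ z, ‖g.1 z‖ ≤ C)
    (t : UnitAddTorus (Fin 2)) : ‖torusLift g.1 t‖ ≤ C := h _

lemma norm_fourierCoef_le (n : Fin 2 → ℤ) {g : SmoothT2} {C : ℝ} (h : ∀ z, ‖g.1 z‖ ≤ C) :
    ‖fourierCoef n g‖ ≤ C := by
  refine (norm_integral_le_of_norm_le_const (C := C) (Eventually.of_forall fun t => ?_)).trans ?_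
  · exact (norm_mFourier_smul _ _ _).trans_le (norm_torusLift_le h _)
  · simp

lemma integral_mFourier_smul_torusLift_add (n : Fin 2 → ℤ) (g : SmoothT2) (v : ℂ) :
    ∫ t, UnitAddTorus.mFourier (-n) t • torusLift g.1 (t + torusProj v) =
      torusChar n v * fourierCoef n g := by
  have hshift : ∀ t, UnitAddTorus.mFourier (-n) t • torusLift g.1 (t + torusProj v) =
      torusChar n v • (UnitAddTorus.mFourier (-n) (t + torusProj v) •
        torusLift g.1 (t + torusProj v)) := by
    intro t
    obtain ⟨z, rfl⟩ := torusProj_surjective t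
    rw [smul_smul, ← map_add, mFourier_torusProj, mFourier_torusProj, torusChar_add,
      mul_left_comm, mul_comm (torusChar n v), torusChar_neg_mul_self, mul_one]
  rw [funext hshift, integral_smul, smul_eq_mul, fourierCoef_apply]
  congr 1
  exact integral_add_right_eq_self
    (fun t => UnitAddTorus.mFourier (-n) t • torusLift g.1 t) (torusProj v)

lemma fourierCoef_dirDeriv (n : Fin 2 → ℤ) (v : ℂ) (g : SmoothT2) :
    fourierCoef n (dirDeriv v g) = freq n v * fourierCoef n g := by
  obtain ⟨C, hC⟩ := exists_norm_le_smoothT2 (dirDeriv v g)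
  have hcont : ∀ (h : SmoothT2) (s : ℝ), Continuous fun t =>
      UnitAddTorus.mFourier (-n) t • torusLift h.1 (t + torusProj (s • v)) := fun h s =>
    (UnitAddTorus.mFourier (-n)).continuous.smul
      ((continuous_torusLift h).comp (continuous_add_const _))
  have hintegral := (hasDerivAt_integral_of_dominated_loc_of_deriv_le
    (μ := (volume : Measure (UnitAddTorus (Fin 2)))) (bound := fun _ => C)
    (F' := fun s t => UnitAddTorus.mFourier (-n) t •
      torusLift (dirDeriv v g).1 (t + torusProj (s • v)))
    univ_mem (Eventually.of_forall fun s => (hcont g s).aestronglyMeasurable)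
    ((hcont g 0).integrable_of_hasCompactSupport (HasCompactSupport.of_compactSpace _))
    (hcont (dirDeriv v g) 0).aestronglyMeasurable
    (Eventually.of_forall fun t s _ => (norm_mFourier_smul _ _ _).trans_le (norm_torusLift_le hC _))
    (integrable_const C) (Eventually.of_forall fun t s _ =>
      (hasDerivAt_torusLift_add g v t s).const_mul (UnitAddTorus.mFourier (-n) t))).2
  simp only [integral_mFourier_smul_torusLift_add, zero_smul, torusChar_zero, one_mul] at hintegral
  exact hintegral.unique ((hasDerivAt_torusChar_smul n v).mul_const _)

lemma hasSum_fourierCoef (g : SmoothT2) (hs : Summable fun n => ‖fourierCoef n g‖) (z : ℂ) :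
    HasSum (fun n => fourierCoef n g * torusChar n z) (g.1 z) := by
  have hs' : Summable (UnitAddTorus.mFourierCoeff (⟨_, continuous_torusLift g⟩ :
      C(UnitAddTorus (Fin 2), ℂ))) := Summable.of_norm hs
  have := UnitAddTorus.hasSum_mFourier_series_apply_of_summable hs' (torusProj z)
  simp only [mFourier_torusProj] at this
  exact torusLift_torusProj g z ▸ this

/-- The constant functions on the torus. -/
def constT2 : ℂ →ₗ[ℂ] SmoothT2 where
  toFun c := ⟨fun _ => c, contDiff_const, fun _ _ _ => rfl⟩
  map_add' _ _ := rfl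
  map_smul' _ _ := rfl

lemma coe_constT2 (c : ℂ) : (constT2 c).1 = fun _ => c := rfl

/-- The mean value of a function on the torus. -/
def meanT2 : SmoothT2 →ₗ[ℂ] ℂ := fourierCoef 0

@[simp] lemma meanT2_constT2 (c : ℂ) : meanT2 (constT2 c) = c := by
  have hint : ∀ t, UnitAddTorus.mFourier (-0) t • torusLift (constT2 c).1 t = c := fun t => by
    simp [UnitAddTorus.mFourier_zero, torusLift, coe_constT2]
  rw [meanT2, fourierCoef_apply, funext hint]
  simp

lemma constT2_injective : Function.Injective constT2 :=
  Function.LeftInverse.injective meanT2_constT2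

/-- A family of coefficients that decays faster than every power of the index. -/
def RapidDecay (d : (Fin 2 → ℤ) → ℂ) : Prop := ∀ k : ℕ, Summable fun n => ‖n‖ ^ k * ‖d n‖

/-- The trigonometric series with coefficients `d`; it has the junk value `0` at the points where
it does not converge absolutely. -/
def trigSum (d : (Fin 2 → ℤ) → ℂ) (z : ℂ) : ℂ := ∑' n, d n * torusChar n z

lemma norm_intCast_apply_le (n : Fin 2 → ℤ) (i : Fin 2) : ‖(n i : ℂ)‖ ≤ ‖n‖ := by
  simpa [Int.norm_eq_abs] using norm_le_pi_norm n i

lemma norm_freq_apply_le (n : Fin 2 → ℤ) (z : ℂ) : ‖freq n z‖ ≤ 4 * Real.pi * ‖n‖ * ‖z‖ := by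
  have hre : ‖(z.re : ℂ)‖ ≤ ‖z‖ := by simpa using Complex.abs_re_le_norm z
  have him : ‖(z.im : ℂ)‖ ≤ ‖z‖ := by simpa using Complex.abs_im_le_norm z
  calc ‖freq n z‖ = 2 * Real.pi * ‖(n 0 * z.re + n 1 * z.im : ℂ)‖ := by
        rw [freq_apply, norm_mul]
        simp [abs_of_pos Real.pi_pos]
    _ ≤ 2 * Real.pi * (‖(n 0 : ℂ)‖ * ‖(z.re : ℂ)‖ + ‖(n 1 : ℂ)‖ * ‖(z.im : ℂ)‖) := by
        gcongr
        exact (norm_add_le _ _).trans_eq (by rw [norm_mul, norm_mul])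
    _ ≤ 2 * Real.pi * (‖n‖ * ‖z‖ + ‖n‖ * ‖z‖) := by
        gcongr <;> exact norm_intCast_apply_le n _
    _ = 4 * Real.pi * ‖n‖ * ‖z‖ := by ring

section RapidDecay

variable {d : (Fin 2 → ℤ) → ℂ}

lemma RapidDecay.of_norm_le_mul (h : RapidDecay d) {d' : (Fin 2 → ℤ) → ℂ} {C : ℝ}
    (h' : ∀ n, ‖d' n‖ ≤ C * ‖d n‖) : RapidDecay d' := fun k =>
  Summable.of_nonneg_of_le (fun n => by positivity)
    (fun n => (mul_le_mul_of_nonneg_left (h' n) (by positivity)).trans_eq (mul_left_comm _ _ _))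
    ((h k).mul_left C)

lemma RapidDecay.freq_mul (h : RapidDecay d) (v : ℂ) : RapidDecay fun n => freq n v * d n := by
  intro k
  refine Summable.of_nonneg_of_le (fun n => by positivity) (fun n => ?_)
    ((h (k + 1)).mul_left (4 * Real.pi * ‖v‖))
  calc ‖n‖ ^ k * ‖freq n v * d n‖
      ≤ ‖n‖ ^ k * ((4 * Real.pi * ‖n‖ * ‖v‖) * ‖d n‖) := by
        rw [norm_mul]; gcongr; exact norm_freq_apply_le n v
    _ = 4 * Real.pi * ‖v‖ * (‖n‖ ^ (k + 1) * ‖d n‖) := by ring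

lemma RapidDecay.summable (h : RapidDecay d) (z : ℂ) : Summable fun n => d n * torusChar n z :=
  Summable.of_norm (by simpa [norm_torusChar] using h 0)

lemma norm_smul_torusChar_smul_freq_le (d : (Fin 2 → ℤ) → ℂ) (n : Fin 2 → ℤ) (z : ℂ) :
    ‖d n • (torusChar n z • freq n)‖ ≤ 4 * Real.pi * (‖n‖ ^ 1 * ‖d n‖) := by
  have hfreq : ‖freq n‖ ≤ 4 * Real.pi * ‖n‖ :=
    ContinuousLinearMap.opNorm_le_bound _ (by positivity) (norm_freq_apply_le n)
  calc ‖d n • (torusChar n z • freq n)‖ = ‖d n‖ * ‖freq n‖ := by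
        rw [norm_smul, norm_smul, norm_torusChar, one_mul]
    _ ≤ ‖d n‖ * (4 * Real.pi * ‖n‖) := by gcongr
    _ = 4 * Real.pi * (‖n‖ ^ 1 * ‖d n‖) := by ring

lemma RapidDecay.hasFDerivAt (h : RapidDecay d) (z : ℂ) :
    HasFDerivAt (trigSum d) (∑' n, d n • (torusChar n z • freq n)) z :=
  hasFDerivAt_tsum ((h 1).mul_left _) (fun n z => (hasFDerivAt_torusChar n z).const_mul (d n))
    (norm_smul_torusChar_smul_freq_le d) (h.summable 0) z

lemma RapidDecay.fderiv_apply (h : RapidDecay d) (z v : ℂ) :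
    fderiv ℝ (trigSum d) z v = trigSum (fun n => freq n v * d n) z := by
  have hsum : Summable fun n => d n • (torusChar n z • freq n) :=
    Summable.of_norm_bounded ((h 1).mul_left _) fun n => norm_smul_torusChar_smul_freq_le d n z
  rw [(h.hasFDerivAt z).fderiv]
  refine ((ContinuousLinearMap.apply ℝ ℂ v).map_tsum hsum).trans (tsum_congr fun n => ?_)
  change d n * (torusChar n z * freq n v) = _
  ring

lemma RapidDecay.contDiff (h : RapidDecay d) : ContDiff ℝ ∞ (trigSum d) := by
  refine contDiff_infty.2 fun k => ?_
  induction k generalizing d with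
  | zero =>
    have : Differentiable ℝ (trigSum d) := fun z => (h.hasFDerivAt z).differentiableAt
    exact contDiff_zero.2 this.continuous
  | succ k ih =>
    push_cast
    refine contDiff_succ_iff_fderiv.2
      ⟨fun z => (h.hasFDerivAt z).differentiableAt, fun h => by simp at h, ?_⟩
    refine contDiff_clm_apply_iff.2 fun v => ?_
    simp_rw [h.fderiv_apply]
    exact ih (h.freq_mul v)

/-- The smooth function on the torus with the rapidly decaying Fourier coefficients `d`. -/
def RapidDecay.toSmooth (h : RapidDecay d) : SmoothT2 :=
  ⟨trigSum d, h.contDiff, fun a b z => by simp only [trigSum, torusChar_add_gauss]⟩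

end RapidDecay

/-! ### The operators `(∂_x + ε ∂_y) / 2` on the torus -/

/-- The operator `(∂_x + ε ∂_y) / 2` on functions on the torus: this is `∂/∂z` for `ε = -i` and
`∂/∂z̄` for `ε = i`. It is elliptic when `ε` is not real. -/
def wirtDeriv (ε : ℂ) : SmoothT2 →ₗ[ℂ] SmoothT2 :=
  (1 / 2 : ℂ) • (dirDeriv 1 + ε • dirDeriv Complex.I)

lemma wirtDeriv_apply (ε : ℂ) (g : SmoothT2) (z : ℂ) :
    (wirtDeriv ε g).1 z = 1 / 2 * (fderiv ℝ g.1 z 1 + ε * fderiv ℝ g.1 z Complex.I) := rfl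

/-- The eigenvalue of `wirtDeriv ε` on the character of index `n`. -/
def wirtFreq (ε : ℂ) (n : Fin 2 → ℤ) : ℂ := 1 / 2 * (freq n 1 + ε * freq n Complex.I)

lemma wirtFreq_eq (ε : ℂ) (n : Fin 2 → ℤ) :
    wirtFreq ε n = Real.pi * Complex.I * (n 0 + ε * n 1) := by
  simp only [wirtFreq, freq_apply, Complex.one_re, Complex.one_im, Complex.I_re, Complex.I_im,
    Complex.ofReal_one, Complex.ofReal_zero]
  ring

lemma fourierCoef_wirtDeriv (ε : ℂ) (n : Fin 2 → ℤ) (g : SmoothT2) :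
    fourierCoef n (wirtDeriv ε g) = wirtFreq ε n * fourierCoef n g := by
  simp only [wirtDeriv, LinearMap.smul_apply, LinearMap.add_apply, map_smul, map_add,
    fourierCoef_dirDeriv, smul_eq_mul, wirtFreq]
  ring

lemma RapidDecay.wirtDeriv_toSmooth {d : (Fin 2 → ℤ) → ℂ} (h : RapidDecay d) (ε z : ℂ) :
    (wirtDeriv ε h.toSmooth).1 z = trigSum (fun n => wirtFreq ε n * d n) z := by
  rw [wirtDeriv_apply]
  change 1 / 2 * (fderiv ℝ (trigSum d) z 1 + ε * fderiv ℝ (trigSum d) z Complex.I) = _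
  rw [h.fderiv_apply, h.fderiv_apply, trigSum, trigSum, ← tsum_mul_left,
    ← ((h.freq_mul 1).summable z).tsum_add (((h.freq_mul _).summable z).mul_left ε),
    ← tsum_mul_left]
  refine tsum_congr fun n => ?_
  simp only [wirtFreq]
  ring

@[simp] lemma wirtDeriv_constT2 (ε c : ℂ) : wirtDeriv ε (constT2 c) = 0 := by
  ext z
  rw [wirtDeriv_apply, coe_constT2]
  simp

@[simp] lemma meanT2_wirtDeriv (ε : ℂ) (g : SmoothT2) : meanT2 (wirtDeriv ε g) = 0 := by
  rw [meanT2, fourierCoef_wirtDeriv, wirtFreq_eq]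
  simp

/-- Ellipticity: `x + ε y` is an injective real linear function of `(x, y)`, hence bounded below. -/
lemma exists_mul_norm_le_norm_wirtFreq {ε : ℂ} (hε : ε.im ≠ 0) :
    ∃ c > 0, ∀ n, c * ‖n‖ ≤ ‖wirtFreq ε n‖ := by
  let symbol : (Fin 2 → ℝ) →ₗ[ℝ] ℂ :=
    (LinearMap.proj 0).smulRight 1 + (LinearMap.proj 1).smulRight ε
  have symbol_apply : ∀ x, symbol x = x 0 + x 1 * ε := fun x => by simp [symbol]
  have hker : LinearMap.ker symbol = ⊥ := by
    refine LinearMap.ker_eq_bot'.2 fun x hx => ?_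
    rw [symbol_apply] at hx
    have h1 : x 1 = 0 := by simpa [hε] using congrArg Complex.im hx
    have h0 : x 0 = 0 := by simpa [h1] using hx
    ext i
    fin_cases i <;> assumption
  obtain ⟨K, hK, hanti⟩ := symbol.exists_antilipschitzWith hker
  refine ⟨Real.pi * (K : ℝ)⁻¹, by positivity, fun n => ?_⟩
  have hsymbol : symbol (fun i => (n i : ℝ)) = n 0 + ε * n 1 := by
    rw [symbol_apply]; push_cast; ring
  have hnorm : ‖fun i => (n i : ℝ)‖ = ‖n‖ := rfl
  have hbound := hanti.le_mul_norm (map_zero symbol) fun i => (n i : ℝ)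
  rw [hsymbol, hnorm] at hbound
  calc Real.pi * (K : ℝ)⁻¹ * ‖n‖ ≤ Real.pi * ((K : ℝ)⁻¹ * (K * ‖(n 0 + ε * n 1 : ℂ)‖)) := by
        rw [mul_assoc]; gcongr
    _ = ‖wirtFreq ε n‖ := by
        rw [inv_mul_cancel_left₀ (by positivity), wirtFreq_eq, norm_mul, norm_mul,
          Complex.norm_I, mul_one, Complex.norm_real, Real.norm_of_nonneg Real.pi_pos.le]

lemma wirtFreq_ne_zero {ε : ℂ} (hε : ε.im ≠ 0) {n : Fin 2 → ℤ} (hn : n ≠ 0) :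
    wirtFreq ε n ≠ 0 := by
  obtain ⟨c, hc, hbound⟩ := exists_mul_norm_le_norm_wirtFreq hε
  exact norm_pos_iff.1 ((mul_pos hc (norm_pos_iff.2 hn)).trans_le (hbound n))

lemma one_le_norm_of_ne_zero {n : Fin 2 → ℤ} (hn : n ≠ 0) : 1 ≤ ‖n‖ := by
  obtain ⟨i, hi⟩ := Function.ne_iff.1 hn
  refine le_trans ?_ (norm_le_pi_norm n i)
  rw [Int.norm_eq_abs]
  exact_mod_cast Int.one_le_abs hi

lemma exists_pow_mul_norm_fourierCoef_le (g : SmoothT2) (k : ℕ) :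
    ∃ C, ∀ n, ‖n‖ ^ k * ‖fourierCoef n g‖ ≤ C := by
  induction k generalizing g with
  | zero =>
    obtain ⟨C, hC⟩ := exists_norm_le_smoothT2 g
    exact ⟨C, fun n => by simpa using norm_fourierCoef_le n hC⟩
  | succ k ih =>
    obtain ⟨C, hC⟩ := ih (wirtDeriv Complex.I g)
    obtain ⟨c, hc, hfreq⟩ := exists_mul_norm_le_norm_wirtFreq (ε := Complex.I) (by simp)
    refine ⟨c⁻¹ * C, fun n => (le_inv_mul_iff₀ hc).2 (le_trans ?_ (hC n))⟩
    calc c * (‖n‖ ^ (k + 1) * ‖fourierCoef n g‖)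
        = ‖n‖ ^ k * (c * ‖n‖ * ‖fourierCoef n g‖) := by ring
      _ ≤ ‖n‖ ^ k * ‖fourierCoef n (wirtDeriv Complex.I g)‖ := by
        rw [fourierCoef_wirtDeriv, norm_mul]
        gcongr
        exact hfreq n

lemma rapidDecay_fourierCoef (g : SmoothT2) : RapidDecay fun n => fourierCoef n g := by
  intro k
  obtain ⟨C, hC⟩ := exists_pow_mul_norm_fourierCoef_le g (k + 3)
  have hsum := (EisensteinSeries.summable_one_div_norm_rpow (k := 3) (by norm_num)).mul_left C
  refine Summable.of_norm_bounded_eventually hsum ?_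
  have hne : ∀ᶠ n : Fin 2 → ℤ in cofinite, n ≠ 0 := by
    rw [eventually_cofinite]
    simp
  filter_upwards [hne] with n hn
  have hn' : 0 < ‖n‖ := norm_pos_iff.2 hn
  have hcube : ‖n‖ ^ (3 : ℝ) = ‖n‖ ^ 3 := by exact_mod_cast Real.rpow_natCast ‖n‖ 3
  rw [norm_mul, norm_norm, norm_pow, norm_norm, Real.rpow_neg hn'.le, ← div_eq_mul_inv,
    le_div_iff₀ (by positivity), hcube]
  calc ‖n‖ ^ k * ‖fourierCoef n g‖ * ‖n‖ ^ 3 = ‖n‖ ^ (k + 3) * ‖fourierCoef n g‖ := by ring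
    _ ≤ C := hC n

lemma trigSum_fourierCoef (g : SmoothT2) (z : ℂ) :
    trigSum (fun n => fourierCoef n g) z = g.1 z := by
  refine (hasSum_fourierCoef g ?_ z).tsum_eq
  simpa using rapidDecay_fourierCoef g 0

lemma eq_constT2_of_wirtDeriv_eq_zero {ε : ℂ} (hε : ε.im ≠ 0) {g : SmoothT2}
    (h : wirtDeriv ε g = 0) : g = constT2 (meanT2 g) := by
  ext z
  rw [← trigSum_fourierCoef, trigSum, tsum_eq_single 0]
  · simp [torusChar, freq_apply, meanT2, coe_constT2]
  · intro n hn
    have hcoef := fourierCoef_wirtDeriv ε n g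
    rw [h, map_zero] at hcoef
    rw [(mul_eq_zero.1 hcoef.symm).resolve_left (wirtFreq_ne_zero hε hn), zero_mul]

lemma rapidDecay_inv_wirtFreq_mul {ε : ℂ} (hε : ε.im ≠ 0) (g : SmoothT2) :
    RapidDecay fun n => (wirtFreq ε n)⁻¹ * fourierCoef n g := by
  obtain ⟨c, hc, hbound⟩ := exists_mul_norm_le_norm_wirtFreq hε
  refine (rapidDecay_fourierCoef g).of_norm_le_mul (C := c⁻¹) fun n => ?_
  rw [norm_mul, norm_inv]
  rcases eq_or_ne n 0 with rfl | hn
  · simp only [wirtFreq_eq, Pi.zero_apply, Int.cast_zero, mul_zero, add_zero, norm_zero, inv_zero,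
      zero_mul]
    positivity
  · gcongr
    calc c = c * 1 := (mul_one c).symm
      _ ≤ c * ‖n‖ := by gcongr; exact one_le_norm_of_ne_zero hn
      _ ≤ ‖wirtFreq ε n‖ := hbound n

lemma exists_wirtDeriv_eq {ε : ℂ} (hε : ε.im ≠ 0) {g : SmoothT2} (h : meanT2 g = 0) :
    ∃ f, wirtDeriv ε f = g ∧ meanT2 f = 0 := by
  have hd := rapidDecay_inv_wirtFreq_mul hε g
  have hf : wirtDeriv ε hd.toSmooth = g := by
    ext z
    rw [hd.wirtDeriv_toSmooth, ← trigSum_fourierCoef g]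
    congr 1
    funext n
    rcases eq_or_ne n 0 with rfl | hn
    · rw [show fourierCoef 0 g = 0 from h, mul_zero, mul_zero]
    · rw [mul_inv_cancel_left₀ (wirtFreq_ne_zero hε hn)]
  refine ⟨hd.toSmooth - constT2 (meanT2 hd.toSmooth), ?_, ?_⟩
  · rw [map_sub, hf, wirtDeriv_constT2, sub_zero]
  · rw [map_sub, meanT2_constT2, sub_self]

/-! ### Basic forms depend on `z` only -/

lemma exists_norm_sub_gauss_le (z : ℂ) : ∃ m n : ℤ, ‖z - gauss m n‖ ≤ 2 := by
  refine ⟨⌊z.re⌋, ⌊z.im⌋, (Complex.norm_le_abs_re_add_abs_im _).trans ?_⟩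
  have hre : (z - gauss ⌊z.re⌋ ⌊z.im⌋).re = Int.fract z.re := by simp [gauss, Int.self_sub_floor]
  have him : (z - gauss ⌊z.re⌋ ⌊z.im⌋).im = Int.fract z.im := by simp [gauss, Int.self_sub_floor]
  rw [hre, him, abs_of_nonneg (Int.fract_nonneg _), abs_of_nonneg (Int.fract_nonneg _)]
  linarith [Int.fract_lt_one z.re, Int.fract_lt_one z.im]

lemma exists_seq_tendsto_mul_eq_add_gauss (u z : ℂ) :
    ∃ (y : ℕ → ℂ) (m n : ℕ → ℤ), Tendsto y atTop (𝓝 z) ∧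
      ∀ k, ((k + 1 : ℕ) : ℂ) * y k = u + gauss (m k) (n k) := by
  choose m n hmn using fun k : ℕ => exists_norm_sub_gauss_le ((k + 1 : ℕ) * z - u)
  have hk : ∀ k : ℕ, ((k + 1 : ℕ) : ℂ) ≠ 0 := fun k => by exact_mod_cast k.succ_ne_zero
  refine ⟨fun k => (u + gauss (m k) (n k)) / (k + 1 : ℕ), m, n, ?_,
    fun k => mul_div_cancel₀ _ (hk k)⟩
  rw [tendsto_iff_norm_sub_tendsto_zero]
  have hzero : Tendsto (fun k : ℕ => 2 * (1 / ((k : ℝ) + 1))) atTop (𝓝 0) := by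
    simpa using tendsto_one_div_add_atTop_nhds_zero_nat.const_mul (2 : ℝ)
  refine squeeze_zero (fun _ => norm_nonneg _) (fun k => ?_) hzero
  calc ‖(u + gauss (m k) (n k)) / (k + 1 : ℕ) - z‖
      = ‖((k + 1 : ℕ) * z - u) - gauss (m k) (n k)‖ / (k + 1 : ℕ) := by
        rw [div_sub' (hk k), norm_div, Complex.norm_natCast, ← norm_neg]
        congr 2
        ring
    _ ≤ 2 / (k + 1 : ℕ) := by gcongr; exact hmn k
    _ = 2 * (1 / ((k : ℝ) + 1)) := by push_cast; ring

/-- The monodromy translates `w` by multiples of `z` and the lattice translates it by `ℤ[i]`. Over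
the dense set of `z` for which some multiple of `z` is congruent to `u`, these identify `u` and
`0`. -/
lemma eq_of_shear_invariant {X : Type*} [TopologicalSpace X] [T2Space X] {f : ℂ × ℂ → X}
    (hf : Continuous f) (hlattice : ∀ (m n : ℤ) (w z : ℂ), f (w + gauss m n, z) = f (w, z))
    (hshear : ∀ t, f (shear t) = f t) (u z : ℂ) : f (u, z) = f (0, z) := by
  have hiterate : ∀ (k : ℕ) (w z : ℂ), f (w + k * z, z) = f (w, z) := by
    intro k w z
    induction k with
    | zero => simp
    | succ k ih =>
      rw [← ih, ← hshear (w + k * z, z)]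
      congr 1
      ext <;> simp [shear]
      ring
  obtain ⟨y, m, n, hy, hmul⟩ := exists_seq_tendsto_mul_eq_add_gauss u z
  have hlim : ∀ w : ℂ, Tendsto (fun k => f (w, y k)) atTop (𝓝 (f (w, z))) := fun w =>
    ((hf.comp (by fun_prop : Continuous fun z : ℂ => (w, z))).tendsto z).comp hy
  refine tendsto_nhds_unique (hlim u) ((hlim 0).congr fun k => ?_)
  rw [← hiterate (k + 1), zero_add, hmul, hlattice]

lemma eval_eq_of_norm_eval_natCast_le {p : Polynomial ℂ} {C : ℝ}
    (h : ∀ n : ℕ, ‖p.eval (n : ℂ)‖ ≤ C) (a b : ℂ) : p.eval a = p.eval b := by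
  rcases lt_or_ge 0 p.degree with hp | hp
  · have hnat : Tendsto (fun n : ℕ => ‖(n : ℂ)‖) atTop atTop := by
      simpa using tendsto_natCast_atTop_atTop (R := ℝ)
    obtain ⟨n, hn⟩ :=
      ((p.tendsto_norm_atTop hp hnat).eventually (eventually_gt_atTop C)).exists
    exact absurd (h n) (not_le.2 hn)
  · rw [Polynomial.eq_C_of_degree_le_zero hp, Polynomial.eval_C, Polynomial.eval_C]

lemma exists_polynomial_eval_eq_add_smul {R A ι : Type*} {M : ι → Type*} [CommSemiring R]
    [CommSemiring A] [Algebra R A] [Finite ι] [∀ i, AddCommMonoid (M i)] [∀ i, Module R (M i)]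
    (a : MultilinearMap R M A) (u v : ∀ i, M i) :
    ∃ p : Polynomial A, ∀ t : R, p.eval (algebraMap R A t) = a (v + t • u) := by
  classical
  cases nonempty_fintype ι
  refine ⟨∑ s : Finset ι, Polynomial.C (a (s.piecewise u v)) * Polynomial.X ^ s.card,
    fun t => ?_⟩
  rw [add_comm, a.map_add_univ, Polynomial.eval_finsetSum]
  refine Finset.sum_congr rfl fun s _ => ?_
  have hsmul := a.map_piecewise_smul (fun _ => t) (s.piecewise u v) s
  have hpiecewise : s.piecewise (fun i => t • s.piecewise u v i) (s.piecewise u v) =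
      s.piecewise (t • u) v := by
    funext i
    by_cases hi : i ∈ s <;> simp [hi]
  rw [← hpiecewise, hsmul, Finset.prod_const, Algebra.smul_def, map_pow, Polynomial.eval_C_mul,
    Polynomial.eval_X_pow, mul_comm]

lemma map_add_smul_eq_of_norm_le {ι : Type*} {M : ι → Type*} [Finite ι]
    [∀ i, AddCommMonoid (M i)] [∀ i, Module ℝ (M i)] (a : MultilinearMap ℝ M ℂ) (u v : ∀ i, M i)
    {C : ℝ} (h : ∀ n : ℕ, ‖a (v + (n : ℝ) • u)‖ ≤ C) (t : ℝ) : a (v + t • u) = a v := by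
  obtain ⟨p, hp⟩ := exists_polynomial_eval_eq_add_smul a u v
  have hbound : ∀ n : ℕ, ‖p.eval (n : ℂ)‖ ≤ C := fun n => by simpa [← hp] using h n
  calc a (v + t • u) = p.eval (algebraMap ℝ ℂ 0) := by
        rw [← hp, eval_eq_of_norm_eval_natCast_le hbound]
    _ = a v := by rw [hp, zero_smul, add_zero]

/-- The nilpotent part `N = monoLin - 1` of the monodromy. -/
def monoNil : Cover →L[ℝ] Cover := monoLin - ContinuousLinearMap.id ℝ Cover

lemma monoNil_apply (u : Cover) : monoNil u = ((u.1.2, 0), 0) := by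
  ext <;> simp [monoNil, monoLin, shear]

section IsBasic

variable {k : ℕ} {α : KForm k}

lemma IsBasic.eq_of_fst_eq (h : IsBasic α) {x y : Cover} (hxy : x.1 = y.1) : α x = α y := by
  rw [← add_sub_cancel y x, h.transl y (x - y) (by simp [hxy])]

lemma IsBasic.exists_norm_le (h : IsBasic α) : ∃ C, ∀ x, ‖α x‖ ≤ C := by
  obtain ⟨C, hC⟩ := ((isCompact_closedBall (0 : Cover) 2).image
    h.smooth.continuous).isBounded.exists_norm_le
  refine ⟨C, fun x => ?_⟩
  obtain ⟨m, n, hw⟩ := exists_norm_sub_gauss_le x.1.1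
  obtain ⟨m', n', hz⟩ := exists_norm_sub_gauss_le x.1.2
  have hx : α x = α ((x.1.1 - gauss m n, x.1.2 - gauss m' n'), 0) := by
    rw [← h.lattice m n m' n' ((x.1.1 - gauss m n, x.1.2 - gauss m' n'), 0)]
    exact h.eq_of_fst_eq (by ext <;> simp)
  rw [hx]
  refine hC _ ⟨_, ?_, rfl⟩
  rw [mem_closedBall_zero_iff]
  simp [Prod.norm_def, hw, hz]

lemma IsBasic.apply_add_nat_smul_monoNil (h : IsBasic α) (n : ℕ) (w z : ℂ) (s : ℝ)
    (v : Fin k → Cover) :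
    α ((w + n * z, z), s) (v + (n : ℝ) • fun i => monoNil (v i)) = α ((w, z), s) v := by
  induction n with
  | zero => simp
  | succ n ih =>
    rw [← ih, ← h.mono ((w + n * z, z), s)]
    rw [h.eq_of_fst_eq (y := TorusSuspension.mono ((w + n * z, z), s))]
    · congr 1
      funext i
      ext <;> simp [monoLin, shear, monoNil_apply]
      ring
    · ext <;> simp [TorusSuspension.mono, shear]
      ring

lemma IsBasic.apply_add_smul_monoNil (h : IsBasic α) (x : Cover) (v : Fin k → Cover) (t : ℝ) :
    α x (v + t • fun i => monoNil (v i)) = α x v := by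
  obtain ⟨C, hC⟩ := h.exists_norm_le
  refine map_add_smul_eq_of_norm_le (C := C * ∏ i, ‖v i‖) (α x).toMultilinearMap _ v
    (fun n => ?_) t
  have hiterate := h.apply_add_nat_smul_monoNil n (x.1.1 - n * x.1.2) x.1.2 x.2 v
  rw [sub_add_cancel] at hiterate
  calc ‖α x (v + (n : ℝ) • fun i => monoNil (v i))‖
      = ‖α ((x.1.1 - n * x.1.2, x.1.2), x.2) v‖ := congrArg norm hiterate
    _ ≤ C * ∏ i, ‖v i‖ := ((α _).le_opNorm v).trans (by gcongr; exact hC _)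

lemma map_monoLin_eq_add_monoNil (v : Fin k → Cover) :
    (fun i => monoLin (v i)) = v + (1 : ℝ) • fun i => monoNil (v i) := by
  funext i
  simp [monoNil]

lemma IsBasic.eq_base (h : IsBasic α) (x : Cover) : α x = α ((0, x.1.2), 0) := by
  refine (h.eq_of_fst_eq (x := x) (y := (x.1, 0)) rfl).trans ?_
  refine eq_of_shear_invariant (f := fun t => α (t, 0))
    (h.smooth.continuous.comp (by fun_prop)) (fun m n w z => ?_) (fun t => ?_) x.1.1 x.1.2
  · simpa [gauss] using h.lattice m n 0 0 ((w, z), 0)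
  · ext v
    rw [h.eq_of_fst_eq (x := (shear t, 0)) (y := TorusSuspension.mono (t, 0)) rfl,
      ← h.mono (t, 0), map_monoLin_eq_add_monoNil, h.apply_add_smul_monoNil]

end IsBasic

/-! ### Invariant constant forms -/

/-- A constant form on the transversal that is invariant under the one-parameter group `exp(tN)`
through the linear part of the monodromy. -/
structure IsInvariant {k : ℕ} (a : Cover [⋀^Fin k]→L[ℝ] ℂ) : Prop where
  vert : ∀ (v : Fin k → Cover) (i : Fin k), (v i).1 = 0 → a v = 0
  inv : ∀ (v : Fin k → Cover) (t : ℝ), a (v + t • fun i => monoNil (v i)) = a v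

section IsInvariant

variable {k : ℕ} {a : Cover [⋀^Fin k]→L[ℝ] ℂ}

lemma IsBasic.isInvariant {α : KForm k} (h : IsBasic α) (x : Cover) : IsInvariant (α x) :=
  ⟨h.contr x, h.apply_add_smul_monoNil x⟩

lemma IsInvariant.zero : IsInvariant (0 : Cover [⋀^Fin k]→L[ℝ] ℂ) :=
  ⟨fun _ _ _ => rfl, fun _ _ => rfl⟩

lemma IsInvariant.map_monoLin (ha : IsInvariant a) (v : Fin k → Cover) :
    a (fun i => monoLin (v i)) = a v := by
  rw [map_monoLin_eq_add_monoNil, ha.inv]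

lemma IsInvariant.sum_update_monoNil (ha : IsInvariant a) (v : Fin k → Cover) :
    ∑ i, a (Function.update v i (monoNil (v i))) = 0 := by
  have hline : HasDerivAt (fun t : ℝ => v + t • fun i => monoNil (v i))
      (fun i => monoNil (v i)) 0 := by
    simpa using ((hasDerivAt_id (0 : ℝ)).smul_const fun i => monoNil (v i)).const_add v
  have hderiv := (a.hasFDerivAt (v + (0 : ℝ) • fun i => monoNil (v i))).comp_hasDerivAt 0 hline
  have hconst : (a ∘ fun t : ℝ => v + t • fun i => monoNil (v i)) = fun _ => a v :=
    funext fun t => ha.inv v t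
  rw [hconst] at hderiv
  simpa using hderiv.unique (hasDerivAt_const (0 : ℝ) (a v))

end IsInvariant

/-- The real coordinate vectors `∂/∂x₁, ∂/∂y₁, ∂/∂x₂, ∂/∂y₂` with `w = x₁ + i y₁`,
`z = x₂ + i y₂`. -/
def frame : Fin 4 → Cover :=
  ![((1, 0), 0), ((Complex.I, 0), 0), ((0, 1), 0), ((0, Complex.I), 0)]

/-- The basis of the cover that consists of `frame` and the leaf direction. -/
def coverBasis : Module.Basis (Fin 4 ⊕ Unit) ℝ Cover :=
  ((Complex.basisOneI.prod Complex.basisOneI).reindex finSumFinEquiv).prod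
    (Module.Basis.singleton Unit ℝ)

lemma coverBasis_inl (i : Fin 4) : coverBasis (Sum.inl i) = frame i := by
  have h0 : (finSumFinEquiv (m := 2) (n := 2)).symm 0 = Sum.inl 0 := rfl
  have h1 : (finSumFinEquiv (m := 2) (n := 2)).symm 1 = Sum.inl 1 := rfl
  have h2 : (finSumFinEquiv (m := 2) (n := 2)).symm 2 = Sum.inr 0 := rfl
  have h3 : (finSumFinEquiv (m := 2) (n := 2)).symm 3 = Sum.inr 1 := rfl
  fin_cases i <;> simp [coverBasis, frame, h0, h1, h2, h3]

lemma coverBasis_inr_fst (i : Unit) : (coverBasis (Sum.inr i)).1 = 0 := by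
  simp [coverBasis]

lemma monoNil_frame : monoNil (frame 0) = 0 ∧ monoNil (frame 1) = 0 ∧
    monoNil (frame 2) = frame 0 ∧ monoNil (frame 3) = frame 1 := by
  simp [monoNil_apply, frame]

namespace IsInvariant

lemma eq_zero_of_frame {k : ℕ} {a : Cover [⋀^Fin k]→L[ℝ] ℂ} (ha : IsInvariant a)
    (h : ∀ v : Fin k → Fin 4, StrictMono v → a (frame ∘ v) = 0) : a = 0 := by
  apply ContinuousAlternatingMap.toAlternatingMap_injective
  refine Module.Basis.ext_alternating coverBasis fun v hv => ?_
  by_cases hleaf : ∃ i j, v i = Sum.inr j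
  · obtain ⟨i, j, hij⟩ := hleaf
    exact ha.vert _ i (by rw [hij, coverBasis_inr_fst])
  · have hinl : ∀ i, ∃ j, v i = Sum.inl j := fun i => by
      rcases hvi : v i with j | j
      · exact ⟨j, rfl⟩
      · exact absurd ⟨i, j, hvi⟩ hleaf
    choose w hw using hinl
    have hsorted : StrictMono (w ∘ Tuple.sort w) :=
      (Tuple.monotone_sort w).strictMono_of_injective
        (.comp (fun i j hij => hv (by rw [hw, hw, hij])) (Tuple.sort w).injective)
    have hperm := a.toAlternatingMap.map_perm (frame ∘ w) (Tuple.sort w)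
    have hframe : (fun i => coverBasis (v i)) = frame ∘ w := by
      funext i
      rw [hw, coverBasis_inl, Function.comp_apply]
    rw [hframe]
    exact (smul_eq_zero_iff_eq _).1 (hperm.symm.trans (h _ hsorted))

lemma eq_zero_of_four_lt {k : ℕ} (hk : 4 < k) {a : Cover [⋀^Fin k]→L[ℝ] ℂ} (ha : IsInvariant a) :
    a = 0 := by
  refine ha.eq_zero_of_frame fun v hv => absurd (Fintype.card_le_of_injective v hv.injective) ?_
  simpa using hk

lemma eq_zero_of_frame_zero {a : Cover [⋀^Fin 0]→L[ℝ] ℂ} (ha : IsInvariant a) (h : a ![] = 0) :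
    a = 0 :=
  ha.eq_zero_of_frame fun v _ => by rw [Subsingleton.elim (frame ∘ v) ![], h]

lemma monoNil_single {a : Cover [⋀^Fin 1]→L[ℝ] ℂ} (ha : IsInvariant a) (x : Cover) :
    a ![monoNil x] = 0 := by
  have h := ha.sum_update_monoNil ![x]
  have h0 : Function.update ![x] 0 (monoNil x) = ![monoNil x] := by
    funext i; fin_cases i; rfl
  rw [Fin.sum_univ_one] at h
  rwa [← h0]

lemma monoNil_pair {a : Cover [⋀^Fin 2]→L[ℝ] ℂ} (ha : IsInvariant a) (x y : Cover) :
    a ![monoNil x, y] + a ![x, monoNil y] = 0 := by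
  have h := ha.sum_update_monoNil ![x, y]
  have h0 : Function.update ![x, y] 0 (monoNil x) = ![monoNil x, y] := by
    funext i; fin_cases i <;> rfl
  have h1 : Function.update ![x, y] 1 (monoNil y) = ![x, monoNil y] := by
    funext i; fin_cases i <;> rfl
  rw [Fin.sum_univ_two] at h
  rwa [← h0, ← h1]

lemma monoNil_triple {a : Cover [⋀^Fin 3]→L[ℝ] ℂ} (ha : IsInvariant a) (x y z : Cover) :
    a ![monoNil x, y, z] + a ![x, monoNil y, z] + a ![x, y, monoNil z] = 0 := by
  have h := ha.sum_update_monoNil ![x, y, z]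
  have h0 : Function.update ![x, y, z] 0 (monoNil x) = ![monoNil x, y, z] := by
    funext i; fin_cases i <;> rfl
  have h1 : Function.update ![x, y, z] 1 (monoNil y) = ![x, monoNil y, z] := by
    funext i; fin_cases i <;> rfl
  have h2 : Function.update ![x, y, z] 2 (monoNil z) = ![x, y, monoNil z] := by
    funext i; fin_cases i <;> rfl
  rw [Fin.sum_univ_three] at h
  rwa [← h0, ← h1, ← h2]

lemma frame_pair_one_two {a : Cover [⋀^Fin 2]→L[ℝ] ℂ} (ha : IsInvariant a) :
    a ![frame 1, frame 2] = a ![frame 0, frame 3] := by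
  have h := ha.monoNil_pair (frame 2) (frame 3)
  have hswap : a ![frame 2, frame 1] = -a ![frame 1, frame 2] := by
    simpa using a.toAlternatingMap.map_swap ![frame 1, frame 2] (i := 0) (j := 1) (by decide)
  simp only [monoNil_frame, hswap] at h
  exact (add_neg_eq_zero.1 h).symm

lemma eq_zero_of_frame_single {a : Cover [⋀^Fin 1]→L[ℝ] ℂ} (ha : IsInvariant a)
    (h2 : a ![frame 2] = 0) (h3 : a ![frame 3] = 0) : a = 0 := by
  have h0 : a ![frame 0] = 0 := by simpa only [monoNil_frame] using ha.monoNil_single (frame 2)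
  have h1 : a ![frame 1] = 0 := by simpa only [monoNil_frame] using ha.monoNil_single (frame 3)
  refine ha.eq_zero_of_frame fun v _ => ?_
  rw [show frame ∘ v = ![frame (v 0)] from funext fun i => by rw [Subsingleton.elim i 0]; rfl]
  generalize v 0 = i
  fin_cases i <;> assumption

lemma eq_zero_of_frame_pair {a : Cover [⋀^Fin 2]→L[ℝ] ℂ} (ha : IsInvariant a)
    (h02 : a ![frame 0, frame 2] = 0) (h03 : a ![frame 0, frame 3] = 0)
    (h13 : a ![frame 1, frame 3] = 0) (h23 : a ![frame 2, frame 3] = 0) : a = 0 := by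
  have h01 : a ![frame 0, frame 1] = 0 := by
    have hzero : a ![0, frame 3] = 0 := a.map_coord_zero 0 rfl
    simpa [monoNil_frame, hzero] using ha.monoNil_pair (frame 0) (frame 3)
  have h12 : a ![frame 1, frame 2] = 0 := ha.frame_pair_one_two.trans h03
  refine ha.eq_zero_of_frame fun v hv => ?_
  have hv01 : v 0 < v 1 := hv (by decide)
  rw [show frame ∘ v = ![frame (v 0), frame (v 1)] by funext i; fin_cases i <;> rfl]
  generalize v 0 = i, v 1 = j at hv01
  fin_cases i <;> fin_cases j <;> first | assumption | exact absurd hv01 (by decide)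

lemma eq_zero_of_frame_triple {a : Cover [⋀^Fin 3]→L[ℝ] ℂ} (ha : IsInvariant a)
    (h023 : a ![frame 0, frame 2, frame 3] = 0) (h123 : a ![frame 1, frame 2, frame 3] = 0) :
    a = 0 := by
  have h012 : a ![frame 0, frame 1, frame 2] = 0 := by
    have hrepeat : a ![frame 0, frame 3, frame 0] = 0 :=
      a.map_eq_zero_of_eq _ (i := 0) (j := 2) rfl (by decide)
    have hzero : a ![0, frame 3, frame 2] = 0 := a.map_coord_zero 0 rfl
    simpa [monoNil_frame, hrepeat, hzero] using ha.monoNil_triple (frame 0) (frame 3) (frame 2)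
  have h013 : a ![frame 0, frame 1, frame 3] = 0 := by
    have hrepeat : a ![frame 2, frame 1, frame 1] = 0 :=
      a.map_eq_zero_of_eq _ (i := 1) (j := 2) rfl (by decide)
    have hzero : a ![frame 2, 0, frame 3] = 0 := a.map_coord_zero 1 rfl
    simpa [monoNil_frame, hrepeat, hzero] using ha.monoNil_triple (frame 2) (frame 1) (frame 3)
  refine ha.eq_zero_of_frame fun v hv => ?_
  have hv01 : v 0 < v 1 := hv (by decide)
  have hv12 : v 1 < v 2 := hv (by decide)
  rw [show frame ∘ v = ![frame (v 0), frame (v 1), frame (v 2)] by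
    funext i; fin_cases i <;> rfl]
  generalize v 0 = i, v 1 = j, v 2 = l at hv01 hv12
  fin_cases i <;> fin_cases j <;> fin_cases l <;>
    first | assumption | exact absurd hv01 (by decide) | exact absurd hv12 (by decide)

lemma eq_zero_of_frame_four {a : Cover [⋀^Fin 4]→L[ℝ] ℂ} (ha : IsInvariant a)
    (h : a frame = 0) : a = 0 := by
  refine ha.eq_zero_of_frame fun v hv => ?_
  rw [hv.eq_id, Function.comp_id, h]

end IsInvariant

/-! ### Coordinates on the space of basic forms -/

/-- Families of forms with constant coefficients, one in each degree. -/
abbrev ConstForm : Type := (k : ℕ) → Cover [⋀^Fin k]→L[ℝ] ℂ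

lemma isInvariant_single {k : ℕ} {a : Cover [⋀^Fin k]→L[ℝ] ℂ} (ha : IsInvariant a) (l : ℕ) :
    IsInvariant ((Pi.single k a : ConstForm) l) := by
  rcases eq_or_ne l k with rfl | hl
  · rwa [Pi.single_eq_same]
  · rw [Pi.single_eq_of_ne hl]
    exact .zero

/-- The form `g(z) a`. -/
def scaled (g : ℂ → ℂ) (a : ConstForm) : RawForm := fun k x => g x.1.2 • a k

lemma scaled_apply (g : ℂ → ℂ) (a : ConstForm) (k : ℕ) (x : Cover) :
    scaled g a k x = g x.1.2 • a k := rfl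

lemma term_eq_scaled {k : ℕ} (g : ℂ → ℂ) (η : Fin k → Cover →L[ℝ] ℂ) :
    term g η = scaled g (Pi.single k (wedge η)) := by
  funext l x
  rcases eq_or_ne l k with rfl | hl
  · simp [term, scaled]
  · simp only [term, scaled, Pi.single_eq_of_ne hl]
    exact (smul_zero (A := Cover [⋀^Fin l]→L[ℝ] ℂ) (g x.1.2)).symm

lemma contDiff_scaled (g : SmoothT2) (a : ConstForm) (k : ℕ) :
    ContDiff ℝ ∞ (scaled g.1 a k) :=
  (g.2.1.comp (contDiff_snd.comp contDiff_fst)).smul contDiff_const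

lemma isBasic_scaled {k : ℕ} {a : ConstForm} (ha : IsInvariant (a k)) (g : SmoothT2) :
    IsBasic (scaled g.1 a k) := by
  have hcontr : ∀ (x : Cover) (v : Fin k → Cover) (i : Fin k), (v i).1 = 0 →
      scaled g.1 a k x v = 0 := fun x v i hi => by
    rw [scaled_apply, ContinuousAlternatingMap.smul_apply, ha.vert v i hi, smul_zero]
  refine ⟨contDiff_scaled g a k, fun m n m' n' x => ?_, fun x v => ?_, hcontr,
    contr_d_of_transl (contDiff_scaled g a k) hcontr fun x u hu => ?_⟩
  · simp [scaled_apply, g.2.2]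
  · simp [scaled_apply, ha.map_monoLin, TorusSuspension.mono, shear]
  · simp [scaled_apply, hu]

lemma dw_apply (u : Cover) : dw u = u.1.1 := rfl

lemma dz_apply (u : Cover) : dz u = u.1.2 := rfl

lemma dwBar_apply (u : Cover) : dwBar u = starRingEnd ℂ u.1.1 := rfl

lemma dzBar_apply (u : Cover) : dzBar u = starRingEnd ℂ u.1.2 := rfl

/-- The labels of the forms `1`, `dz`, `dz̄`, `dw ∧ dz`, `θ = dw ∧ dz̄ + dw̄ ∧ dz`, `dz ∧ dz̄`,
`dw̄ ∧ dz̄`, `dw ∧ dz ∧ dz̄`, `dz ∧ dw̄ ∧ dz̄` and `dw ∧ dz ∧ dw̄ ∧ dz̄`, which freely generate the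
basic forms over `SmoothT2`. -/
inductive Generator
  | one | z | zBar | wZ | theta | zZBar | wBarZBar | wZZBar | zWBarZBar | top
  deriving DecidableEq

namespace Generator

instance : Fintype Generator where
  elems := {one, z, zBar, wZ, theta, zZBar, wBarZBar, wZZBar, zWBarZBar, top}
  complete i := by cases i <;> decide

/-- The bidegree of a generator. -/
def bideg : Generator → ℕ × ℕ
  | one => (0, 0)
  | z => (1, 0)
  | zBar => (0, 1)
  | wZ => (2, 0)
  | theta => (1, 1)
  | zZBar => (1, 1)
  | wBarZBar => (0, 2)
  | wZZBar => (2, 1)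
  | zWBarZBar => (1, 2)
  | top => (2, 2)

/-- The constant form that a generator stands for. -/
def form : Generator → ConstForm
  | one => Pi.single 0 (wedge ![])
  | z => Pi.single 1 (wedge ![dz])
  | zBar => Pi.single 1 (wedge ![dzBar])
  | wZ => Pi.single 2 (wedge ![dw, dz])
  | theta => Pi.single 2 (wedge ![dw, dzBar] + wedge ![dwBar, dz])
  | zZBar => Pi.single 2 (wedge ![dz, dzBar])
  | wBarZBar => Pi.single 2 (wedge ![dwBar, dzBar])
  | wZZBar => Pi.single 3 (wedge ![dw, dz, dzBar])
  | zWBarZBar => Pi.single 3 (wedge ![dz, dwBar, dzBar])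
  | top => Pi.single 4 (wedge ![dw, dz, dwBar, dzBar])

end Generator

lemma wedge_zero (η : Fin 0 → Cover →L[ℝ] ℂ) (v : Fin 0 → Cover) : wedge η v = 1 := by
  rw [wedge_apply, Matrix.det_fin_zero]

lemma wedge_one (a : Cover →L[ℝ] ℂ) (v : Fin 1 → Cover) : wedge ![a] v = a (v 0) := by
  rw [wedge_apply, Matrix.det_fin_one]
  rfl

lemma wedge_two (a b : Cover →L[ℝ] ℂ) (v : Fin 2 → Cover) :
    wedge ![a, b] v = a (v 0) * b (v 1) - a (v 1) * b (v 0) := by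
  rw [wedge_apply, Matrix.det_fin_two]
  rfl

lemma wedge_vecCons {k : ℕ} (b : Cover →L[ℝ] ℂ) (η : Fin k → Cover →L[ℝ] ℂ)
    (v : Fin (k + 1) → Cover) :
    wedge (Matrix.vecCons b η) v =
      ∑ i : Fin (k + 1), (-1) ^ (i : ℕ) * b (v i) * wedge η (i.removeNth v) := by
  simp only [wedge_apply, Matrix.det_succ_row_zero]
  rfl

lemma wedge_three (a b c : Cover →L[ℝ] ℂ) (v : Fin 3 → Cover) :
    wedge ![a, b, c] v = a (v 0) * b (v 1) * c (v 2) - a (v 0) * b (v 2) * c (v 1) -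
      a (v 1) * b (v 0) * c (v 2) + a (v 1) * b (v 2) * c (v 0) +
      a (v 2) * b (v 0) * c (v 1) - a (v 2) * b (v 1) * c (v 0) := by
  simp [wedge_vecCons a, wedge_two, Fin.sum_univ_three, Fin.removeNth, Fin.succAbove]
  ring

lemma wedge_vert {k : ℕ} {η : Fin k → Cover →L[ℝ] ℂ} (h : ∀ i, η i ∈ [dw, dz, dwBar, dzBar])
    (v : Fin k → Cover) (i : Fin k) (hi : (v i).1 = 0) : wedge η v = 0 := by
  rw [wedge_apply]
  refine Matrix.det_eq_zero_of_column_eq_zero i fun j => ?_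
  have hj := h j
  simp only [List.mem_cons, List.not_mem_nil, or_false] at hj
  rcases hj with h | h | h | h <;>
    simp [h, dw_apply, dz_apply, dwBar_apply, dzBar_apply, hi]

lemma covector_monoNil (u : Cover) : dw (monoNil u) = dz u ∧ dz (monoNil u) = 0 ∧
    dwBar (monoNil u) = dzBar u ∧ dzBar (monoNil u) = 0 := by
  simp [dw_apply, dz_apply, dwBar_apply, dzBar_apply, monoNil_apply]

lemma isInvariant_theta : IsInvariant (wedge ![dw, dzBar] + wedge ![dwBar, dz]) := by
  refine ⟨fun v i hi => ?_, fun v t => ?_⟩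
  · rw [ContinuousAlternatingMap.add_apply, wedge_vert (by simp [Fin.forall_fin_succ]) v i hi,
      wedge_vert (by simp [Fin.forall_fin_succ]) v i hi, add_zero]
  · simp [wedge_two, covector_monoNil]
    ring

lemma Generator.isInvariant_form (i : Generator) (k : ℕ) : IsInvariant (i.form k) := by
  cases i
  case theta => exact isInvariant_single isInvariant_theta k
  all_goals
    refine isInvariant_single ⟨wedge_vert (by simp [Fin.forall_fin_succ]), fun v t => ?_⟩ k
    simp [wedge_zero, wedge_one, wedge_two, wedge_three, wedge_vecCons dw ![dz, dwBar, dzBar],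
      covector_monoNil, Fin.sum_univ_four, Fin.removeNth, Fin.succAbove]
    try ring

/-- The basic form `g(z) i`. -/
def gen (i : Generator) : SmoothT2 →ₗ[ℂ] basicForms where
  toFun g := ⟨scaled g.1 i.form, fun k => isBasic_scaled (i.isInvariant_form k) g⟩
  map_add' g h := Subtype.ext <| funext fun k => funext fun x =>
    add_smul (g.1 x.1.2) (h.1 x.1.2) (i.form k)
  map_smul' c g := Subtype.ext <| funext fun k => funext fun x =>
    smul_assoc c (g.1 x.1.2) (i.form k)

/-- The basic form with given coefficients with respect to the generators. -/
def ofCoords : (Generator → SmoothT2) →ₗ[ℂ] basicForms :=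
  ∑ i, gen i ∘ₗ LinearMap.proj i

lemma ofCoords_apply (f : Generator → SmoothT2) : ofCoords f = ∑ i, gen i (f i) := by
  simp [ofCoords]

/-- The function `z ↦ α ((0, z), 0) v` of a basic form `α`. -/
def evalBase {k : ℕ} (v : Fin k → Cover) : basicForms →ₗ[ℂ] SmoothT2 where
  toFun α := ⟨fun z => α.1 k ((0, z), 0) v,
    (ContinuousAlternatingMap.apply ℝ Cover ℂ v).contDiff.comp
      ((α.2 k).smooth.comp (by fun_prop)), fun m n z => by
    have h := (α.2 k).lattice 0 0 m n ((0, z), 0)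
    simp only [gauss, Int.cast_zero, zero_mul, add_zero, Prod.mk_add_mk] at h ⊢
    rw [h]⟩
  map_add' _ _ := rfl
  map_smul' _ _ := rfl

/-- The coefficient of a basic form at a generator. -/
def coord : Generator → basicForms →ₗ[ℂ] SmoothT2
  | .one => evalBase ![]
  | .z => (1 / 2 : ℂ) • (evalBase ![frame 2] - Complex.I • evalBase ![frame 3])
  | .zBar => (1 / 2 : ℂ) • (evalBase ![frame 2] + Complex.I • evalBase ![frame 3])
  | .wZ => (1 / 4 : ℂ) • (evalBase ![frame 0, frame 2] - evalBase ![frame 1, frame 3] -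
      (2 * Complex.I) • evalBase ![frame 0, frame 3])
  | .theta => (1 / 4 : ℂ) • (evalBase ![frame 0, frame 2] + evalBase ![frame 1, frame 3])
  | .zZBar => (Complex.I / 2) • evalBase ![frame 2, frame 3]
  | .wBarZBar => (1 / 4 : ℂ) • (evalBase ![frame 0, frame 2] - evalBase ![frame 1, frame 3] +
      (2 * Complex.I) • evalBase ![frame 0, frame 3])
  | .wZZBar => (1 / 4 : ℂ) • (evalBase ![frame 1, frame 2, frame 3] +
      Complex.I • evalBase ![frame 0, frame 2, frame 3])
  | .zWBarZBar => (1 / 4 : ℂ) • (evalBase ![frame 1, frame 2, frame 3] -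
      Complex.I • evalBase ![frame 0, frame 2, frame 3])
  | .top => (1 / 4 : ℂ) • evalBase frame

lemma evalBase_apply {k : ℕ} (v : Fin k → Cover) (α : basicForms) (z : ℂ) :
    (evalBase v α).1 z = α.1 k ((0, z), 0) v := rfl

lemma evalBase_gen {k : ℕ} (v : Fin k → Cover) (i : Generator) (g : SmoothT2) (z : ℂ) :
    (evalBase v (gen i g)).1 z = g.1 z * i.form k v := rfl

lemma dw_frame (i : Fin 4) : dw (frame i) = ![1, Complex.I, 0, 0] i := by
  fin_cases i <;> simp [dw_apply, frame]

lemma dz_frame (i : Fin 4) : dz (frame i) = ![0, 0, 1, Complex.I] i := by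
  fin_cases i <;> simp [dz_apply, frame]

lemma dwBar_frame (i : Fin 4) : dwBar (frame i) = ![1, -Complex.I, 0, 0] i := by
  fin_cases i <;> simp [dwBar_apply, frame]

lemma dzBar_frame (i : Fin 4) : dzBar (frame i) = ![0, 0, 1, -Complex.I] i := by
  fin_cases i <;> simp [dzBar_apply, frame]

lemma wedge_frame_four : wedge ![dw, dz, dwBar, dzBar] frame = 4 := by
  rw [wedge_vecCons, Fin.sum_univ_four]
  simp [wedge_three, dw_frame, dz_frame, dwBar_frame, dzBar_frame, Fin.removeNth, Fin.tail,
    Fin.succAbove]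
  ring_nf
  norm_num

lemma coord_gen (i j : Generator) (g : SmoothT2) :
    coord i (gen j g) = if i = j then g else 0 := by
  ext z
  cases i <;> cases j
  all_goals
    simp [coord, evalBase_gen, Generator.form, wedge_zero, wedge_one, wedge_two, wedge_three,
      wedge_frame_four, dw_frame, dz_frame, dwBar_frame, dzBar_frame]
  all_goals ring_nf
  all_goals simp only [Complex.I_sq]
  all_goals ring

lemma coord_ofCoords (f : Generator → SmoothT2) (i : Generator) : coord i (ofCoords f) = f i := by
  simp [ofCoords_apply, coord_gen]

lemma IsBasic.eq_zero_of_base {k : ℕ} {α : KForm k} (h : IsBasic α)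
    (h0 : ∀ z, α ((0, z), 0) = 0) : α = 0 :=
  funext fun x => (h.eq_base x).trans (h0 _)

lemma eq_zero_of_coord_eq_zero {α : basicForms} (h : ∀ i, coord i α = 0) : α = 0 := by
  refine Subtype.ext <| funext fun k => (α.2 k).eq_zero_of_base fun z => ?_
  have hinv := (α.2 k).isInvariant ((0, z), 0)
  have hc : ∀ i, (coord i α).1 z = 0 := fun i => by rw [h]; rfl
  have hz := hc .z
  have hzBar := hc .zBar
  have hwZ := hc .wZ
  have htheta := hc .theta
  have hzZBar := hc .zZBar
  have hwBarZBar := hc .wBarZBar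
  have hwZZBar := hc .wZZBar
  have hzWBarZBar := hc .zWBarZBar
  simp only [coord, LinearMap.smul_apply, LinearMap.add_apply, LinearMap.sub_apply,
    Submodule.coe_smul, Submodule.coe_add, Submodule.coe_sub, Pi.smul_apply, Pi.add_apply,
    Pi.sub_apply, evalBase_apply, smul_eq_mul]
    at hz hzBar hwZ htheta hzZBar hwBarZBar hwZZBar hzWBarZBar
  match k, hinv with
  | 0, hinv => exact hinv.eq_zero_of_frame_zero (hc .one)
  | 1, hinv =>
    exact hinv.eq_zero_of_frame_single (by linear_combination hz + hzBar)
      (by linear_combination Complex.I * (hz - hzBar) + α.1 1 _ ![frame 3] * Complex.I_sq)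
  | 2, hinv =>
    exact hinv.eq_zero_of_frame_pair (by linear_combination hwZ + hwBarZBar + 2 * htheta)
      (by linear_combination Complex.I * (hwZ - hwBarZBar) +
        α.1 2 _ ![frame 0, frame 3] * Complex.I_sq)
      (by linear_combination 2 * htheta - hwZ - hwBarZBar)
      (by linear_combination -2 * Complex.I * hzZBar + α.1 2 _ ![frame 2, frame 3] * Complex.I_sq)
  | 3, hinv =>
    exact hinv.eq_zero_of_frame_triple
      (by linear_combination -2 * Complex.I * (hwZZBar - hzWBarZBar) +
        α.1 3 _ ![frame 0, frame 2, frame 3] * Complex.I_sq)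
      (by linear_combination 2 * (hwZZBar + hzWBarZBar))
  | 4, hinv => exact hinv.eq_zero_of_frame_four (by simpa [coord, evalBase_apply] using hc .top)
  | k + 5, hinv => exact hinv.eq_zero_of_four_lt (by omega)

lemma ofCoords_coord (α : basicForms) : ofCoords (fun i => coord i α) = α := by
  rw [← sub_eq_zero]
  exact eq_zero_of_coord_eq_zero fun i => by rw [map_sub, coord_ofCoords, sub_self]

/-! ### The operators `∂` and `∂̄` in coordinates -/

/-- The 1-form `dx - ε dy` in the coordinate `z = x + i y`: this is `dz` for `ε = -i` and `dz̄` for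
`ε = i`. -/
def wirtCovector (ε : ℂ) : Cover →L[ℝ] ℂ :=
  (Complex.ofRealCLM.comp Complex.reCLM - ε • Complex.ofRealCLM.comp Complex.imCLM).comp dz

lemma wirtCovector_apply (ε : ℂ) (u : Cover) :
    wirtCovector ε u = u.1.2.re - ε * u.1.2.im := rfl

lemma wirtCovector_I : wirtCovector Complex.I = dzBar :=
  ContinuousLinearMap.ext fun u => by
    rw [wirtCovector_apply, dzBar_apply]
    apply Complex.ext <;> simp

lemma wirtCovector_neg_I : wirtCovector (-Complex.I) = dz :=
  ContinuousLinearMap.ext fun u => by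
    rw [wirtCovector_apply, dz_apply]
    apply Complex.ext <;> simp

/-- The exterior product of a covector with an alternating form. -/
def wedgeLeft {k : ℕ} (b : Cover →L[ℝ] ℂ) (a : Cover [⋀^Fin k]→L[ℝ] ℂ) :
    Cover [⋀^Fin (k + 1)]→L[ℝ] ℂ :=
  ContinuousAlternatingMap.alternatizeUncurryFin (b.smulRight a)

lemma wedgeLeft_apply {k : ℕ} (b : Cover →L[ℝ] ℂ) (a : Cover [⋀^Fin k]→L[ℝ] ℂ)
    (v : Fin (k + 1) → Cover) :
    wedgeLeft b a v = ∑ i : Fin (k + 1), (-1) ^ (i : ℕ) * b (v i) * a (i.removeNth v) := by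
  rw [wedgeLeft, ContinuousAlternatingMap.alternatizeUncurryFin_apply]
  refine Finset.sum_congr rfl fun i _ => ?_
  rw [zsmul_eq_mul, mul_assoc]
  push_cast
  rfl

lemma wedgeLeft_zero {k : ℕ} (b : Cover →L[ℝ] ℂ) :
    wedgeLeft b (0 : Cover [⋀^Fin k]→L[ℝ] ℂ) = 0 := by
  ext v
  simp [wedgeLeft_apply]

lemma wedgeLeft_add {k : ℕ} (b : Cover →L[ℝ] ℂ) (a a' : Cover [⋀^Fin k]→L[ℝ] ℂ) :
    wedgeLeft b (a + a') = wedgeLeft b a + wedgeLeft b a' := by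
  ext v
  simp only [wedgeLeft_apply, ContinuousAlternatingMap.add_apply, mul_add, Finset.sum_add_distrib]

lemma wedgeLeft_wedge {k : ℕ} (b : Cover →L[ℝ] ℂ) (η : Fin k → Cover →L[ℝ] ℂ) :
    wedgeLeft b (wedge η) = wedge (Matrix.vecCons b η) := by
  ext v
  rw [wedgeLeft_apply, wedge_vecCons]

lemma wedge_eq_zero {k : ℕ} {η : Fin k → Cover →L[ℝ] ℂ} {i j : Fin k} (hij : i ≠ j)
    (h : η i = η j) : wedge η = 0 := by
  ext v
  rw [wedge_apply]
  exact Matrix.det_zero_of_row_eq hij (funext fun l => by simp [h])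

/-- `wedgeLeft`, on all degrees together. -/
def covectorMul (b : Cover →L[ℝ] ℂ) (a : ConstForm) : ConstForm
  | 0 => 0
  | k + 1 => wedgeLeft b (a k)

lemma covectorMul_single {k : ℕ} (b : Cover →L[ℝ] ℂ) (a : Cover [⋀^Fin k]→L[ℝ] ℂ) :
    covectorMul b (Pi.single k a) = Pi.single (k + 1) (wedgeLeft b a) := by
  funext l
  rcases l with _ | l
  · rw [Pi.single_eq_of_ne (Nat.succ_ne_zero k).symm]
    rfl
  · rcases eq_or_ne l k with rfl | hl
    · rw [Pi.single_eq_same, covectorMul, Pi.single_eq_same]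
    · rw [Pi.single_eq_of_ne (by simpa using hl), covectorMul, Pi.single_eq_of_ne hl,
        wedgeLeft_zero]

lemma fderiv_scaled_apply (g : SmoothT2) (a : ConstForm) (k : ℕ) (x u : Cover)
    (v : Fin k → Cover) :
    fderiv ℝ (scaled g.1 a k) x u v = fderiv ℝ g.1 x.1.2 u.1.2 * a k v := by
  rw [fderiv_eval (contDiff_scaled g a k)]
  have h : HasFDerivAt (fun y : Cover => g.1 y.1.2 * a k v) _ x :=
    ((g.2.1.differentiable (by simp) _).hasFDerivAt.comp x
      ((hasFDerivAt_snd (𝕜 := ℝ) (E := ℂ) (F := ℂ)).comp x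
        (hasFDerivAt_fst (𝕜 := ℝ) (E := ℂ × ℂ) (F := ℝ)))).mul_const (a k v)
  exact (DFunLike.congr_fun h.fderiv u).trans (mul_comm _ _)

lemma map_complex_eq (L : ℂ →L[ℝ] ℂ) (z : ℂ) : L z = z.re * L 1 + z.im * L Complex.I := by
  have hz : z = z.re • (1 : ℂ) + z.im • Complex.I := by simp
  conv_lhs => rw [hz, map_add, map_smul, map_smul, Complex.real_smul, Complex.real_smul]

lemma wirtinger_scaled {ε : ℂ} (hε : ε * ε = -1) (g : SmoothT2) (a : ConstForm) (k : ℕ) :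
    wirtinger ε (scaled g.1 a k) =
      scaled (wirtDeriv ε g).1 (covectorMul (wirtCovector ε) a) (k + 1) := by
  funext x
  ext v
  rw [wirtinger_apply, scaled_apply, ContinuousAlternatingMap.smul_apply, covectorMul,
    wedgeLeft_apply, smul_eq_mul, Finset.mul_sum]
  refine Finset.sum_congr rfl fun i _ => ?_
  have hhor : (hor (v i)).1.2 = (v i).1.2 := rfl
  have hrot : (rot (v i)).1.2 = Complex.I * (v i).1.2 := rfl
  rw [fderiv_scaled_apply, fderiv_scaled_apply, wirtCovector_apply, wirtDeriv_apply, hhor, hrot,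
    map_complex_eq _ (v i).1.2, map_complex_eq _ (Complex.I * (v i).1.2), zsmul_eq_mul]
  simp only [Complex.mul_re, Complex.mul_im, Complex.I_re, Complex.I_im]
  push_cast
  linear_combination ((-1) ^ (i : ℕ) * (1 / 2) * fderiv ℝ g.1 x.1.2 Complex.I * (v i).1.2.im *
    a k (i.removeNth v)) * hε

lemma wirtingerBasic_gen {ε : ℂ} (hε : ε * ε = -1) (i : Generator) (g : SmoothT2) :
    (wirtingerBasic ε (gen i g)).1 =
      scaled (wirtDeriv ε g).1 (covectorMul (wirtCovector ε) i.form) := by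
  funext k
  rcases k with _ | k
  · exact (funext fun x : Cover =>
      smul_zero (A := Cover [⋀^Fin 0]→L[ℝ] ℂ) ((wirtDeriv ε g).1 x.1.2)).symm
  · exact wirtinger_scaled hε g i.form k

namespace Generator

lemma covectorMul_dz_form (i : Generator) : covectorMul dz i.form =
    match i with
    | one => form z
    | zBar => form zZBar
    | theta => -form wZZBar
    | wBarZBar => form zWBarZBar
    | _ => 0 := by
  cases i <;> simp only [form, covectorMul_single, wedgeLeft_add, wedgeLeft_wedge]
  case z => rw [wedge_eq_zero (show (0 : Fin 2) ≠ 1 by decide) rfl, Pi.single_zero]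
  case wZ => rw [wedge_eq_zero (show (0 : Fin 3) ≠ 2 by decide) rfl, Pi.single_zero]
  case theta =>
    rw [wedge_eq_zero (η := ![dz, dwBar, dz]) (show (0 : Fin 3) ≠ 2 by decide) rfl, add_zero,
      ← Pi.single_neg]
    congr 1
    ext v
    rw [ContinuousAlternatingMap.neg_apply, wedge_three, wedge_three]
    ring
  case zZBar => rw [wedge_eq_zero (show (0 : Fin 3) ≠ 1 by decide) rfl, Pi.single_zero]
  case wZZBar => rw [wedge_eq_zero (show (0 : Fin 4) ≠ 2 by decide) rfl, Pi.single_zero]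
  case zWBarZBar => rw [wedge_eq_zero (show (0 : Fin 4) ≠ 1 by decide) rfl, Pi.single_zero]
  case top => rw [wedge_eq_zero (show (0 : Fin 5) ≠ 2 by decide) rfl, Pi.single_zero]

lemma covectorMul_dzBar_form (i : Generator) : covectorMul dzBar i.form =
    match i with
    | one => form zBar
    | z => -form zZBar
    | wZ => form wZZBar
    | theta => -form zWBarZBar
    | _ => 0 := by
  cases i <;> simp only [form, covectorMul_single, wedgeLeft_add, wedgeLeft_wedge]
  case z =>
    rw [← Pi.single_neg]
    congr 1
    ext v
    rw [ContinuousAlternatingMap.neg_apply, wedge_two, wedge_two]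
    ring
  case zBar => rw [wedge_eq_zero (show (0 : Fin 2) ≠ 1 by decide) rfl, Pi.single_zero]
  case wZ =>
    congr 1
    ext v
    rw [wedge_three, wedge_three]
    ring
  case theta =>
    rw [wedge_eq_zero (show (0 : Fin 3) ≠ 2 by decide) rfl, zero_add, ← Pi.single_neg]
    congr 1
    ext v
    rw [ContinuousAlternatingMap.neg_apply, wedge_three, wedge_three]
    ring
  case zZBar => rw [wedge_eq_zero (show (0 : Fin 3) ≠ 2 by decide) rfl, Pi.single_zero]
  case wBarZBar => rw [wedge_eq_zero (show (0 : Fin 3) ≠ 2 by decide) rfl, Pi.single_zero]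
  case wZZBar => rw [wedge_eq_zero (show (0 : Fin 4) ≠ 3 by decide) rfl, Pi.single_zero]
  case zWBarZBar => rw [wedge_eq_zero (show (0 : Fin 4) ≠ 3 by decide) rfl, Pi.single_zero]
  case top => rw [wedge_eq_zero (show (0 : Fin 5) ≠ 4 by decide) rfl, Pi.single_zero]

end Generator

lemma scaled_neg (g : ℂ → ℂ) (a : ConstForm) : scaled g (-a) = -scaled g a :=
  funext fun k => funext fun x => smul_neg (g x.1.2) (a k)

lemma scaled_zero (g : ℂ → ℂ) : scaled g 0 = 0 :=
  funext fun k => funext fun x : Cover => smul_zero (A := Cover [⋀^Fin k]→L[ℝ] ℂ) (g x.1.2)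

open Generator in
lemma del_gen (i : Generator) (g : SmoothT2) : del (gen i g) =
    match i with
    | one => gen z (wirtDeriv (-Complex.I) g)
    | zBar => gen zZBar (wirtDeriv (-Complex.I) g)
    | theta => -gen wZZBar (wirtDeriv (-Complex.I) g)
    | wBarZBar => gen zWBarZBar (wirtDeriv (-Complex.I) g)
    | _ => 0 := by
  ext1
  rw [del, wirtingerBasic_gen (by simp), wirtCovector_neg_I, covectorMul_dz_form]
  cases i
  case theta => exact scaled_neg _ _
  all_goals first | rfl | exact scaled_zero _

open Generator in
lemma delBar_gen (i : Generator) (g : SmoothT2) : delBar (gen i g) =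
    match i with
    | one => gen zBar (wirtDeriv Complex.I g)
    | z => -gen zZBar (wirtDeriv Complex.I g)
    | wZ => gen wZZBar (wirtDeriv Complex.I g)
    | theta => -gen zWBarZBar (wirtDeriv Complex.I g)
    | _ => 0 := by
  ext1
  rw [delBar, wirtingerBasic_gen Complex.I_mul_I, wirtCovector_I, covectorMul_dzBar_form]
  cases i
  case theta => exact scaled_neg _ _
  case z => exact scaled_neg _ _
  all_goals first | rfl | exact scaled_zero _

/-! ### Bidegrees in coordinates -/

/-- The factor by which a form of type `(p, q)` is multiplied when its transverse arguments are
multiplied by `c`. -/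
def typeFactor (c : ℂ) (t : ℕ × ℕ) : ℂ := c ^ t.1 * starRingEnd ℂ c ^ t.2

lemma eq_of_typeFactor_eq {s t : ℕ × ℕ} (h : ∀ c, typeFactor c s = typeFactor c t) : s = t := by
  have hadd : s.1 + s.2 = t.1 + t.2 := by
    have h2 : (2 : ℂ) ^ s.1 * 2 ^ s.2 = 2 ^ t.1 * 2 ^ t.2 := by
      simpa only [typeFactor, map_ofNat] using h 2
    rw [← pow_add, ← pow_add] at h2
    exact Nat.pow_right_injective le_rfl (by exact_mod_cast h2)
  have hexp (r : ℕ × ℕ) : typeFactor (Complex.exp Complex.I) r =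
      Complex.exp (((r.1 - r.2 : ℤ) : ℂ) * Complex.I) := by
    rw [typeFactor, ← Complex.exp_conj, ← Complex.exp_nat_mul, ← Complex.exp_nat_mul,
      ← Complex.exp_add, Complex.conj_I]
    congr 1
    push_cast
    ring
  have hI := h (Complex.exp Complex.I)
  rw [hexp, hexp, Complex.exp_eq_exp_iff_exists_int] at hI
  obtain ⟨n, hn⟩ := hI
  have hpi : ((s.1 - s.2 - (t.1 - t.2) : ℤ) : ℝ) = n * (2 * Real.pi) := by
    have him : (s.1 - s.2 : ℝ) = t.1 - t.2 + n * (2 * Real.pi) := by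
      simpa using congrArg Complex.im hn
    push_cast
    linarith
  rcases eq_or_ne n 0 with rfl | hn0
  · have hsub : (s.1 - s.2 - (t.1 - t.2) : ℤ) = 0 := by
      rw [Int.cast_zero, zero_mul] at hpi
      exact_mod_cast hpi
    exact Prod.ext (by omega) (by omega)
  · have hirr : Irrational ((2 * n : ℤ) * Real.pi) := irrational_pi.intCast_mul (by omega)
    refine absurd ⟨(s.1 - s.2 - (t.1 - t.2) : ℤ), ?_⟩ hirr
    push_cast at hpi ⊢
    linarith

lemma single_dilate {k : ℕ} {a : Cover [⋀^Fin k]→L[ℝ] ℂ} {c χ : ℂ}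
    (h : ∀ v : Fin k → Cover, a (fun j => (c • (v j).1, (v j).2)) = χ * a v) (l : ℕ)
    (v : Fin l → Cover) : (Pi.single k a : ConstForm) l (fun j => (c • (v j).1, (v j).2)) =
      χ * (Pi.single k a : ConstForm) l v := by
  rcases eq_or_ne l k with rfl | hl
  · rw [Pi.single_eq_same]
    exact h v
  · rw [Pi.single_eq_of_ne hl]
    exact (mul_zero χ).symm

namespace Generator

lemma form_dilate (i : Generator) (c : ℂ) (k : ℕ) (v : Fin k → Cover) :
    i.form k (fun j => (c • (v j).1, (v j).2)) = typeFactor c i.bideg * i.form k v := by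
  cases i
  all_goals
    refine single_dilate (fun v => ?_) k v
    simp [bideg, typeFactor, wedge_zero, wedge_one, wedge_two, wedge_three,
      wedge_vecCons dw ![dz, dwBar, dzBar], dw_apply, dz_apply, dwBar_apply, dzBar_apply,
      Fin.sum_univ_four, Fin.removeNth, Fin.succAbove]
    try ring

lemma form_eq_zero_of_ne (i : Generator) {k : ℕ} (hk : k ≠ i.bideg.1 + i.bideg.2) :
    i.form k = 0 := by
  cases i <;> exact Pi.single_eq_of_ne hk _

end Generator

lemma gen_mem_bidegree (i : Generator) (g : SmoothT2) :
    gen i g ∈ bidegree i.bideg.1 i.bideg.2 := by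
  refine ⟨fun k hk => funext fun x => ?_, fun k x c v => ?_⟩
  · exact (congrArg (g.1 x.1.2 • ·) (i.form_eq_zero_of_ne hk)).trans
      (smul_zero (A := Cover [⋀^Fin k]→L[ℝ] ℂ) (g.1 x.1.2))
  · exact (congrArg (g.1 x.1.2 * ·) (i.form_dilate c k v)).trans (mul_left_comm _ _ _)

lemma ofCoords_val (f : Generator → SmoothT2) (k : ℕ) (x : Cover) (v : Fin k → Cover) :
    (ofCoords f).1 k x v = ∑ i, (f i).1 x.1.2 * i.form k v := by
  have hsum : (ofCoords f).1 k x v = ∑ i, (gen i (f i)).1 k x v := by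
    rw [ofCoords_apply]
    simp only [Submodule.coe_sum, Finset.sum_apply, ContinuousAlternatingMap.sum_apply]
  exact hsum

lemma mem_bidegree_iff {p q : ℕ} {α : basicForms} :
    α ∈ bidegree p q ↔ ∀ i : Generator, i.bideg ≠ (p, q) → coord i α = 0 := by
  refine ⟨fun hα i hi => ?_, fun h => ?_⟩
  · have hofCoords (c : ℂ) :
        ofCoords (fun i => (typeFactor c i.bideg - typeFactor c (p, q)) • coord i α) = 0 := by
      ext1
      funext k
      funext x
      ext v
      have hdil := hα.2 k x c v
      have hval := ofCoords_val (fun i => coord i α) k x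
      rw [ofCoords_coord] at hval
      rw [hval, hval, Finset.mul_sum, ← sub_eq_zero, ← Finset.sum_sub_distrib] at hdil
      rw [ofCoords_val, ← (show _ = (0 : basicForms).1 k x v from hdil)]
      refine Finset.sum_congr rfl fun i _ => ?_
      rw [i.form_dilate, typeFactor, typeFactor]
      change _ * (coord i α).1 x.1.2 * _ = _
      ring
    by_contra hne
    refine hi (eq_of_typeFactor_eq fun c => ?_)
    have hc := congrArg (coord i) (hofCoords c)
    rw [coord_ofCoords, map_zero, smul_eq_zero, sub_eq_zero] at hc
    exact hc.resolve_right hne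
  · rw [← ofCoords_coord α, ofCoords_apply]
    refine Submodule.sum_mem _ fun i _ => ?_
    by_cases hi : i.bideg = (p, q)
    · have hmem := gen_mem_bidegree i (coord i α)
      rwa [hi] at hmem
    · rw [h i hi, map_zero]
      exact Submodule.zero_mem _

/-! ### The operators on coefficients -/

lemma Generator.sum_eq {M : Type*} [AddCommMonoid M] (f : Generator → M) :
    ∑ i, f i = f one + (f z + (f zBar + (f wZ + (f theta + (f zZBar + (f wBarZBar +
      (f wZZBar + (f zWBarZBar + f top)))))))) := by
  simp [Finset.univ, Fintype.elems]

lemma eq_of_coord_eq {α β : basicForms} (h : ∀ i, coord i α = coord i β) : α = β :=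
  sub_eq_zero.1 <| eq_zero_of_coord_eq_zero fun i => by rw [map_sub, h, sub_self]

open Generator in
lemma coord_del (i : Generator) (α : basicForms) : coord i (del α) =
    match i with
    | z => wirtDeriv (-Complex.I) (coord one α)
    | zZBar => wirtDeriv (-Complex.I) (coord zBar α)
    | wZZBar => -wirtDeriv (-Complex.I) (coord theta α)
    | zWBarZBar => wirtDeriv (-Complex.I) (coord wBarZBar α)
    | _ => 0 := by
  conv_lhs => rw [← ofCoords_coord α, ofCoords_apply, Generator.sum_eq]
  simp only [map_add, del_gen, map_neg, map_zero, coord_gen]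
  cases i <;> simp

open Generator in
lemma coord_delBar (i : Generator) (α : basicForms) : coord i (delBar α) =
    match i with
    | zBar => wirtDeriv Complex.I (coord one α)
    | zZBar => -wirtDeriv Complex.I (coord z α)
    | wZZBar => wirtDeriv Complex.I (coord wZ α)
    | zWBarZBar => -wirtDeriv Complex.I (coord theta α)
    | _ => 0 := by
  conv_lhs => rw [← ofCoords_coord α, ofCoords_apply, Generator.sum_eq]
  simp only [map_add, delBar_gen, map_neg, map_zero, coord_gen]
  cases i <;> simp

lemma im_neg_I_ne_zero : (-Complex.I).im ≠ 0 := by simp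

lemma im_I_ne_zero : Complex.I.im ≠ 0 := by simp

lemma ker_wirtDeriv {ε : ℂ} (hε : ε.im ≠ 0) :
    LinearMap.ker (wirtDeriv ε) = LinearMap.range constT2 := by
  ext g
  refine ⟨fun h => ⟨_, (eq_constT2_of_wirtDeriv_eq_zero hε h).symm⟩, ?_⟩
  rintro ⟨c, rfl⟩
  exact wirtDeriv_constT2 ε c

lemma range_wirtDeriv {ε : ℂ} (hε : ε.im ≠ 0) :
    LinearMap.range (wirtDeriv ε) = LinearMap.ker meanT2 := by
  ext g
  refine ⟨?_, fun h => (exists_wirtDeriv_eq hε h).imp fun f hf => hf.1⟩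
  rintro ⟨f, rfl⟩
  exact meanT2_wirtDeriv ε f

lemma ker_wirtDeriv_comp {ε ε' : ℂ} (hε : ε.im ≠ 0) (hε' : ε'.im ≠ 0) :
    LinearMap.ker (wirtDeriv ε ∘ₗ wirtDeriv ε') = LinearMap.range constT2 := by
  rw [← ker_wirtDeriv hε']
  refine le_antisymm (fun g hg => ?_) (LinearMap.ker_le_ker_comp _ _)
  have hconst := eq_constT2_of_wirtDeriv_eq_zero hε hg
  rwa [meanT2_wirtDeriv, map_zero] at hconst

lemma range_wirtDeriv_comp {ε ε' : ℂ} (hε : ε.im ≠ 0) (hε' : ε'.im ≠ 0) :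
    LinearMap.range (wirtDeriv ε ∘ₗ wirtDeriv ε') = LinearMap.ker meanT2 := by
  refine le_antisymm ?_ fun g hg => ?_
  · exact (LinearMap.range_comp_le_range _ _).trans (range_wirtDeriv hε).le
  · obtain ⟨f, rfl, hf⟩ := exists_wirtDeriv_eq hε hg
    obtain ⟨e, rfl, -⟩ := exists_wirtDeriv_eq hε' hf
    exact ⟨e, rfl⟩

/-- The basic forms with coefficients in given spaces of functions. -/
def diag (P : Generator → Submodule ℂ SmoothT2) : Submodule ℂ basicForms :=
  ⨅ i, (P i).comap (coord i)

lemma mem_diag {P : Generator → Submodule ℂ SmoothT2} {α : basicForms} :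
    α ∈ diag P ↔ ∀ i, coord i α ∈ P i := by
  simp only [diag, Submodule.mem_iInf, Submodule.mem_comap]

lemma diag_inf (P Q : Generator → Submodule ℂ SmoothT2) :
    diag P ⊓ diag Q = diag (P ⊓ Q) := by
  ext α
  simp only [Submodule.mem_inf, mem_diag, Pi.inf_apply, forall_and]

lemma diag_sup (P Q : Generator → Submodule ℂ SmoothT2) :
    diag P ⊔ diag Q = diag (P ⊔ Q) := by
  refine le_antisymm (sup_le ?_ ?_) fun α hα => ?_
  · exact fun α hα => mem_diag.2 fun i => Submodule.mem_sup_left (mem_diag.1 hα i)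
  · exact fun α hα => mem_diag.2 fun i => Submodule.mem_sup_right (mem_diag.1 hα i)
  · choose f hf g hg hfg using fun i => Submodule.mem_sup.1 (mem_diag.1 hα i)
    refine Submodule.mem_sup.2 ⟨ofCoords f, mem_diag.2 fun i => ?_, ofCoords g,
      mem_diag.2 fun i => ?_, eq_of_coord_eq fun i => ?_⟩
    · rw [coord_ofCoords]
      exact hf i
    · rw [coord_ofCoords]
      exact hg i
    · rw [map_add, coord_ofCoords, coord_ofCoords, hfg]

lemma ker_del : LinearMap.ker del = diag fun
    | .one | .zBar | .theta | .wBarZBar => LinearMap.range constT2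
    | _ => ⊤ := by
  rw [← ker_wirtDeriv im_neg_I_ne_zero]
  ext α
  rw [LinearMap.mem_ker, mem_diag]
  refine ⟨fun h i => ?_, fun h => eq_zero_of_coord_eq_zero fun i => ?_⟩
  · have hcoord (j : Generator) : coord j (del α) = 0 := by rw [h, map_zero]
    cases i
    case one => exact (coord_del .z α).symm.trans (hcoord .z)
    case zBar => exact (coord_del .zZBar α).symm.trans (hcoord .zZBar)
    case theta => exact neg_eq_zero.1 ((coord_del .wZZBar α).symm.trans (hcoord .wZZBar))
    case wBarZBar => exact (coord_del .zWBarZBar α).symm.trans (hcoord .zWBarZBar)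
    all_goals trivial
  · rw [coord_del]
    cases i
    case z => exact h .one
    case zZBar => exact h .zBar
    case wZZBar => exact neg_eq_zero.2 (h .theta)
    case zWBarZBar => exact h .wBarZBar
    all_goals rfl

lemma ker_delBar : LinearMap.ker delBar = diag fun
    | .one | .z | .wZ | .theta => LinearMap.range constT2
    | _ => ⊤ := by
  rw [← ker_wirtDeriv im_I_ne_zero]
  ext α
  rw [LinearMap.mem_ker, mem_diag]
  refine ⟨fun h i => ?_, fun h => eq_zero_of_coord_eq_zero fun i => ?_⟩
  · have hcoord (j : Generator) : coord j (delBar α) = 0 := by rw [h, map_zero]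
    cases i
    case one => exact (coord_delBar .zBar α).symm.trans (hcoord .zBar)
    case z => exact neg_eq_zero.1 ((coord_delBar .zZBar α).symm.trans (hcoord .zZBar))
    case wZ => exact (coord_delBar .wZZBar α).symm.trans (hcoord .wZZBar)
    case theta => exact neg_eq_zero.1 ((coord_delBar .zWBarZBar α).symm.trans (hcoord .zWBarZBar))
    all_goals trivial
  · rw [coord_delBar]
    cases i
    case zBar => exact h .one
    case zZBar => exact neg_eq_zero.2 (h .z)
    case wZZBar => exact h .wZ
    case zWBarZBar => exact neg_eq_zero.2 (h .theta)
    all_goals rfl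

lemma ker_del_inf_ker_delBar : LinearMap.ker del ⊓ LinearMap.ker delBar = diag fun
    | .one | .z | .zBar | .wZ | .theta | .wBarZBar => LinearMap.range constT2
    | _ => ⊤ := by
  rw [ker_del, ker_delBar, diag_inf]
  congr 1
  funext i
  cases i <;> simp

lemma range_del : LinearMap.range del = diag fun
    | .z | .zZBar | .wZZBar | .zWBarZBar => LinearMap.ker meanT2
    | _ => ⊥ := by
  rw [← range_wirtDeriv im_neg_I_ne_zero]
  refine le_antisymm ?_ fun α hα => ?_
  · rintro _ ⟨α, rfl⟩
    refine mem_diag.2 fun i => ?_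
    rw [coord_del]
    cases i
    case wZZBar => exact Submodule.neg_mem _ ⟨_, rfl⟩
    all_goals first | exact ⟨_, rfl⟩ | exact Submodule.zero_mem _
  · rw [mem_diag] at hα
    obtain ⟨f₁, h₁⟩ := hα .z
    obtain ⟨f₂, h₂⟩ := hα .zZBar
    obtain ⟨f₃, h₃⟩ := Submodule.neg_mem _ (hα .wZZBar)
    obtain ⟨f₄, h₄⟩ := hα .zWBarZBar
    refine ⟨ofCoords fun
      | .one => f₁
      | .zBar => f₂
      | .theta => f₃
      | .wBarZBar => f₄
      | _ => 0, eq_of_coord_eq fun i => ?_⟩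
    simp only [coord_del, coord_ofCoords]
    have hi := hα i
    cases i
    case z => exact h₁
    case zZBar => exact h₂
    case wZZBar => exact neg_eq_iff_eq_neg.2 h₃
    case zWBarZBar => exact h₄
    all_goals exact ((Submodule.mem_bot ℂ).1 hi).symm

lemma range_delBar : LinearMap.range delBar = diag fun
    | .zBar | .zZBar | .wZZBar | .zWBarZBar => LinearMap.ker meanT2
    | _ => ⊥ := by
  rw [← range_wirtDeriv im_I_ne_zero]
  refine le_antisymm ?_ fun α hα => ?_
  · rintro _ ⟨α, rfl⟩
    refine mem_diag.2 fun i => ?_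
    rw [coord_delBar]
    cases i
    case zZBar => exact Submodule.neg_mem _ ⟨_, rfl⟩
    case zWBarZBar => exact Submodule.neg_mem _ ⟨_, rfl⟩
    all_goals first | exact ⟨_, rfl⟩ | exact Submodule.zero_mem _
  · rw [mem_diag] at hα
    obtain ⟨f₁, h₁⟩ := hα .zBar
    obtain ⟨f₂, h₂⟩ := Submodule.neg_mem _ (hα .zZBar)
    obtain ⟨f₃, h₃⟩ := hα .wZZBar
    obtain ⟨f₄, h₄⟩ := Submodule.neg_mem _ (hα .zWBarZBar)
    refine ⟨ofCoords fun
      | .one => f₁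
      | .z => f₂
      | .wZ => f₃
      | .theta => f₄
      | _ => 0, eq_of_coord_eq fun i => ?_⟩
    simp only [coord_delBar, coord_ofCoords]
    have hi := hα i
    cases i
    case zBar => exact h₁
    case zZBar => exact neg_eq_iff_eq_neg.2 h₂
    case wZZBar => exact h₃
    case zWBarZBar => exact neg_eq_iff_eq_neg.2 h₄
    all_goals exact ((Submodule.mem_bot ℂ).1 hi).symm

lemma range_del_sup_range_delBar : LinearMap.range del ⊔ LinearMap.range delBar = diag fun
    | .z | .zBar | .zZBar | .wZZBar | .zWBarZBar => LinearMap.ker meanT2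
    | _ => ⊥ := by
  rw [range_del, range_delBar, diag_sup]
  congr 1
  funext i
  cases i <;> simp

lemma coord_del_delBar (i : Generator) (α : basicForms) : coord i (del (delBar α)) =
    if i = .zZBar then (wirtDeriv (-Complex.I) ∘ₗ wirtDeriv Complex.I) (coord .one α) else 0 := by
  cases i <;> simp [coord_del, coord_delBar]

lemma ker_del_comp_delBar : LinearMap.ker (del ∘ₗ delBar) = diag fun
    | .one => LinearMap.range constT2
    | _ => ⊤ := by
  rw [← ker_wirtDeriv_comp im_neg_I_ne_zero im_I_ne_zero]
  ext α
  rw [LinearMap.mem_ker, mem_diag]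
  refine ⟨fun h i => ?_, fun h => eq_zero_of_coord_eq_zero fun i => ?_⟩
  · cases i
    case one =>
      have hcoord := (coord_del_delBar .zZBar α).symm
      rw [if_pos rfl] at hcoord
      exact hcoord.trans ((congrArg (coord .zZBar) h).trans (map_zero _))
    all_goals trivial
  · rw [LinearMap.comp_apply, coord_del_delBar]
    split_ifs
    · exact h .one
    · rfl

lemma range_del_comp_delBar : LinearMap.range (del ∘ₗ delBar) = diag fun
    | .zZBar => LinearMap.ker meanT2
    | _ => ⊥ := by
  rw [← range_wirtDeriv_comp im_neg_I_ne_zero im_I_ne_zero]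
  refine le_antisymm ?_ fun α hα => ?_
  · rintro _ ⟨α, rfl⟩
    refine mem_diag.2 fun i => ?_
    rw [LinearMap.comp_apply, coord_del_delBar]
    cases i
    case zZBar => exact ⟨_, rfl⟩
    all_goals exact Submodule.zero_mem _
  · rw [mem_diag] at hα
    obtain ⟨f, hf⟩ := hα .zZBar
    refine ⟨gen .one f, eq_of_coord_eq fun i => ?_⟩
    rw [LinearMap.comp_apply, coord_del_delBar, coord_gen, if_pos rfl]
    have hi := hα i
    cases i
    case zZBar => exact hf
    all_goals exact ((Submodule.mem_bot ℂ).1 hi).symm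

/-! ### Cohomology -/

section Represents

variable {X Y V : Type} [AddCommGroup X] [Module ℂ X] [AddCommGroup Y] [Module ℂ Y]
  [AddCommGroup V] [Module ℂ V]

/-- `ψ` takes its values in `Z` and induces a bijection onto the quotient `Z / (B ∩ Z)`. -/
structure Represents (ψ : X →ₗ[ℂ] V) (Z B : Submodule ℂ V) : Prop where
  mem : ∀ x, ψ x ∈ Z
  eq_zero : ∀ x, ψ x ∈ B → x = 0
  exists_sub_mem : ∀ v ∈ Z, ∃ x, v - ψ x ∈ B

lemma Represents.isoByClasses {ψ : X →ₗ[ℂ] basicForms} {Z B : Submodule ℂ basicForms}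
    (h : Represents ψ Z B) {θ : X → RawForm} (hθ : ∀ x, (ψ x).1 = θ x) : IsoByClasses Z B θ := by
  let φ : X →ₗ[ℂ] QuotBy Z B := (B.submoduleOf Z).mkQ ∘ₗ ψ.codRestrict Z h.mem
  have hinj : Function.Injective φ := by
    refine (injective_iff_map_eq_zero φ).2 fun x hx => h.eq_zero x ?_
    exact (Submodule.Quotient.mk_eq_zero (B.submoduleOf Z)).1 hx
  have hsurj : Function.Surjective φ := fun v => by
    obtain ⟨α, rfl⟩ := (B.submoduleOf Z).mkQ_surjective v
    obtain ⟨x, hx⟩ := h.exists_sub_mem α.1 α.2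
    exact ⟨x, ((Submodule.Quotient.eq (B.submoduleOf Z) (y := ⟨ψ x, h.mem x⟩)).2 hx).symm⟩
  exact ⟨.ofBijective φ ⟨hinj, hsurj⟩, fun x => ⟨⟨ψ x, h.mem x⟩, hθ x, rfl⟩⟩

lemma represents_id : Represents (LinearMap.id : V →ₗ[ℂ] V) ⊤ ⊥ where
  mem _ := trivial
  eq_zero _ hx := hx
  exists_sub_mem v _ := ⟨v, by simp⟩

lemma represents_constT2_range : Represents constT2 (LinearMap.range constT2) ⊥ where
  mem x := ⟨x, rfl⟩
  eq_zero _ hx := constT2_injective (hx.trans (map_zero _).symm)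
  exists_sub_mem := by
    rintro _ ⟨c, rfl⟩
    exact ⟨c, by simp⟩

lemma represents_constT2_top : Represents constT2 ⊤ (LinearMap.ker meanT2) where
  mem _ := trivial
  eq_zero x hx := (meanT2_constT2 x).symm.trans hx
  exists_sub_mem g _ := ⟨meanT2 g, by simp⟩

variable {P Q : Generator → Submodule ℂ SmoothT2} {ψ : X →ₗ[ℂ] SmoothT2} {χ : Y →ₗ[ℂ] SmoothT2}
  {i j : Generator} {p q : ℕ}

lemma Represents.gen (h : Represents ψ (P i) (Q i))
    (hi : ∀ k : Generator, k.bideg = (p, q) ↔ k = i) :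
    Represents (gen i ∘ₗ ψ) (diag P ⊓ bidegree p q) (diag Q ⊓ bidegree p q) := by
  have hcoord (x : X) : coord i ((TorusSuspension.gen i ∘ₗ ψ) x) = ψ x := by
    simp [coord_gen]
  have hcoord' (x : X) {k : Generator} (hk : k ≠ i) :
      coord k ((TorusSuspension.gen i ∘ₗ ψ) x) = 0 := by
    simp [coord_gen, hk]
  have hbideg (x : X) : (TorusSuspension.gen i ∘ₗ ψ) x ∈ bidegree p q :=
    mem_bidegree_iff.2 fun k hk => hcoord' x (mt (hi k).2 hk)
  refine ⟨fun x => ⟨mem_diag.2 fun k => ?_, hbideg x⟩, fun x hx => h.eq_zero x ?_, ?_⟩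
  · rcases eq_or_ne k i with rfl | hk
    · exact (hcoord x).symm ▸ h.mem x
    · exact (hcoord' x hk).symm ▸ Submodule.zero_mem _
  · exact hcoord x ▸ mem_diag.1 hx.1 i
  · rintro α ⟨hα, hαpq⟩
    obtain ⟨x, hx⟩ := h.exists_sub_mem _ (mem_diag.1 hα i)
    refine ⟨x, mem_diag.2 fun k => ?_, Submodule.sub_mem _ hαpq (hbideg x)⟩
    rcases eq_or_ne k i with rfl | hk
    · rwa [map_sub, hcoord]
    · rw [map_sub, hcoord' x hk, mem_bidegree_iff.1 hαpq k (mt (hi k).1 hk), sub_zero]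
      exact Submodule.zero_mem _

lemma Represents.gen_add_gen (h : Represents ψ (P i) (Q i)) (h' : Represents χ (P j) (Q j))
    (hij : i ≠ j) (hi : ∀ k : Generator, k.bideg = (p, q) ↔ k = i ∨ k = j) :
    Represents ((TorusSuspension.gen i ∘ₗ ψ).coprod (TorusSuspension.gen j ∘ₗ χ))
      (diag P ⊓ bidegree p q) (diag Q ⊓ bidegree p q) := by
  set Ψ := (TorusSuspension.gen i ∘ₗ ψ).coprod (TorusSuspension.gen j ∘ₗ χ) with hΨ
  have hcoord (x : X × Y) : coord i (Ψ x) = ψ x.1 := by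
    simp [hΨ, coord_gen, hij]
  have hcoord' (x : X × Y) : coord j (Ψ x) = χ x.2 := by
    simp [hΨ, coord_gen, hij.symm]
  have hcoord₀ (x : X × Y) {k : Generator} (hk : ¬(k = i ∨ k = j)) : coord k (Ψ x) = 0 := by
    rw [not_or] at hk
    simp [hΨ, coord_gen, hk.1, hk.2]
  have hbideg (x : X × Y) : Ψ x ∈ bidegree p q :=
    mem_bidegree_iff.2 fun k hk => hcoord₀ x (mt (hi k).2 hk)
  refine ⟨fun x => ⟨mem_diag.2 fun k => ?_, hbideg x⟩, fun x hx => ?_, ?_⟩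
  · by_cases hk : k = i ∨ k = j
    · rcases hk with rfl | rfl
      · exact (hcoord x).symm ▸ h.mem x.1
      · exact (hcoord' x).symm ▸ h'.mem x.2
    · exact (hcoord₀ x hk).symm ▸ Submodule.zero_mem _
  · exact Prod.ext (h.eq_zero _ (hcoord x ▸ mem_diag.1 hx.1 i))
      (h'.eq_zero _ (hcoord' x ▸ mem_diag.1 hx.1 j))
  · rintro α ⟨hα, hαpq⟩
    obtain ⟨x, hx⟩ := h.exists_sub_mem _ (mem_diag.1 hα i)
    obtain ⟨y, hy⟩ := h'.exists_sub_mem _ (mem_diag.1 hα j)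
    refine ⟨(x, y), mem_diag.2 fun k => ?_, Submodule.sub_mem _ hαpq (hbideg _)⟩
    by_cases hk : k = i ∨ k = j
    · rcases hk with rfl | rfl
      · rwa [map_sub, hcoord]
      · rwa [map_sub, hcoord']
    · rw [map_sub, hcoord₀ _ hk, mem_bidegree_iff.1 hαpq k (mt (hi k).1 hk), sub_zero]
      exact Submodule.zero_mem _

end Represents

section Tables

variable {X Y : Type} [AddCommGroup X] [Module ℂ X] [AddCommGroup Y] [Module ℂ Y]
  {K I : Submodule ℂ basicForms} {P Q : Generator → Submodule ℂ SmoothT2}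
  {ψ : X →ₗ[ℂ] SmoothT2} {χ : Y →ₗ[ℂ] SmoothT2} {p q : ℕ}

lemma Represents.isoByClasses_gen {θ : X → RawForm} (i : Generator)
    (h : Represents ψ (P i) (Q i)) (hK : K = diag P) (hI : I = diag Q)
    (hi : ∀ k : Generator, k.bideg = (p, q) ↔ k = i) (hθ : ∀ x, θ x = scaled (ψ x).1 i.form) :
    IsoByClasses (K ⊓ bidegree p q) (I ⊓ bidegree p q) θ := by
  subst hK hI
  exact (h.gen hi).isoByClasses fun x => (hθ x).symm

lemma mixed_eq_scaled (g : ℂ → ℂ) : mixed g = scaled g Generator.theta.form := by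
  funext k x
  rw [mixed, term_eq_scaled, term_eq_scaled, Generator.form, Pi.single_add]
  exact (smul_add ..).symm

lemma Represents.isoByClasses_gen_add_gen {θ : X × Y → RawForm}
    (h : Represents ψ (P .theta) (Q .theta)) (h' : Represents χ (P .zZBar) (Q .zZBar))
    (hK : K = diag P) (hI : I = diag Q)
    (hθ : ∀ x, θ x = mixed (ψ x.1).1 + term (χ x.2).1 ![dz, dzBar]) :
    IsoByClasses (K ⊓ bidegree 1 1) (I ⊓ bidegree 1 1) θ := by
  subst hK hI
  refine (h.gen_add_gen h' (by decide) (by decide)).isoByClasses fun x => ?_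
  rw [hθ, mixed_eq_scaled, term_eq_scaled]
  rfl

lemma dolbeault_table :
    DolbeaultVia 0 0 (fun a : ℂ => term (fun _ => a) ![]) ∧
    DolbeaultVia 1 0 (fun a : ℂ => term (fun _ => a) ![dz]) ∧
    DolbeaultVia 2 0 (fun a : ℂ => term (fun _ => a) ![dw, dz]) ∧
    DolbeaultVia 0 1 (fun a : ℂ => term (fun _ => a) ![dzBar]) ∧
    DolbeaultVia 1 1
      (fun a : ℂ × ℂ => mixed (fun _ => a.1) + term (fun _ => a.2) ![dz, dzBar]) ∧
    DolbeaultVia 2 1 (fun a : ℂ => term (fun _ => a) ![dw, dz, dzBar]) ∧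
    DolbeaultVia 0 2 (fun g : SmoothT2 => term g.1 ![dwBar, dzBar]) ∧
    DolbeaultVia 1 2 (fun a : ℂ => term (fun _ => a) ![dz, dwBar, dzBar]) ∧
    DolbeaultVia 2 2 (fun g : SmoothT2 => term g.1 ![dw, dz, dwBar, dzBar]) := by
  have hZ := ker_delBar
  have hB := range_delBar
  refine ⟨?_, ?_, ?_, ?_, ?_, ?_, ?_, ?_, ?_⟩
  · exact represents_constT2_range.isoByClasses_gen .one hZ hB (by decide) fun _ =>
      term_eq_scaled ..
  · exact represents_constT2_range.isoByClasses_gen .z hZ hB (by decide) fun _ => term_eq_scaled ..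
  · exact represents_constT2_range.isoByClasses_gen .wZ hZ hB (by decide) fun _ => term_eq_scaled ..
  · exact represents_constT2_top.isoByClasses_gen .zBar hZ hB (by decide) fun _ => term_eq_scaled ..
  · exact represents_constT2_range.isoByClasses_gen_add_gen represents_constT2_top hZ hB
      fun _ => by simp only [coe_constT2]
  · exact represents_constT2_top.isoByClasses_gen .wZZBar hZ hB (by decide) fun _ =>
      term_eq_scaled ..
  · exact represents_id.isoByClasses_gen .wBarZBar hZ hB (by decide) fun _ => term_eq_scaled ..
  · exact represents_constT2_top.isoByClasses_gen .zWBarZBar hZ hB (by decide) fun _ =>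
      term_eq_scaled ..
  · exact represents_id.isoByClasses_gen .top hZ hB (by decide) fun _ => term_eq_scaled ..

lemma bottChern_table :
    BottChernVia 0 0 (fun a : ℂ => term (fun _ => a) ![]) ∧
    BottChernVia 1 0 (fun a : ℂ => term (fun _ => a) ![dz]) ∧
    BottChernVia 2 0 (fun a : ℂ => term (fun _ => a) ![dw, dz]) ∧
    BottChernVia 0 1 (fun a : ℂ => term (fun _ => a) ![dzBar]) ∧
    BottChernVia 1 1
      (fun a : ℂ × ℂ => mixed (fun _ => a.1) + term (fun _ => a.2) ![dz, dzBar]) ∧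
    BottChernVia 2 1 (fun g : SmoothT2 => term g.1 ![dw, dz, dzBar]) ∧
    BottChernVia 0 2 (fun a : ℂ => term (fun _ => a) ![dwBar, dzBar]) ∧
    BottChernVia 1 2 (fun g : SmoothT2 => term g.1 ![dz, dwBar, dzBar]) ∧
    BottChernVia 2 2 (fun g : SmoothT2 => term g.1 ![dw, dz, dwBar, dzBar]) := by
  have hZ := ker_del_inf_ker_delBar
  have hB := range_del_comp_delBar
  refine ⟨?_, ?_, ?_, ?_, ?_, ?_, ?_, ?_, ?_⟩
  · exact represents_constT2_range.isoByClasses_gen .one hZ hB (by decide) fun _ =>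
      term_eq_scaled ..
  · exact represents_constT2_range.isoByClasses_gen .z hZ hB (by decide) fun _ => term_eq_scaled ..
  · exact represents_constT2_range.isoByClasses_gen .wZ hZ hB (by decide) fun _ => term_eq_scaled ..
  · exact represents_constT2_range.isoByClasses_gen .zBar hZ hB (by decide) fun _ =>
      term_eq_scaled ..
  · exact represents_constT2_range.isoByClasses_gen_add_gen represents_constT2_top hZ hB
      fun _ => by simp only [coe_constT2]
  · exact represents_id.isoByClasses_gen .wZZBar hZ hB (by decide) fun _ => term_eq_scaled ..
  · exact represents_constT2_range.isoByClasses_gen .wBarZBar hZ hB (by decide) fun _ =>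
      term_eq_scaled ..
  · exact represents_id.isoByClasses_gen .zWBarZBar hZ hB (by decide) fun _ => term_eq_scaled ..
  · exact represents_id.isoByClasses_gen .top hZ hB (by decide) fun _ => term_eq_scaled ..

lemma aeppli_table :
    AeppliVia 0 0 (fun a : ℂ => term (fun _ => a) ![]) ∧
    AeppliVia 1 0 (fun a : ℂ => term (fun _ => a) ![dz]) ∧
    AeppliVia 2 0 (fun g : SmoothT2 => term g.1 ![dw, dz]) ∧
    AeppliVia 0 1 (fun a : ℂ => term (fun _ => a) ![dzBar]) ∧
    AeppliVia 1 1
      (fun a : SmoothT2 × ℂ => mixed a.1.1 + term (fun _ => a.2) ![dz, dzBar]) ∧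
    AeppliVia 2 1 (fun a : ℂ => term (fun _ => a) ![dw, dz, dzBar]) ∧
    AeppliVia 0 2 (fun g : SmoothT2 => term g.1 ![dwBar, dzBar]) ∧
    AeppliVia 1 2 (fun a : ℂ => term (fun _ => a) ![dz, dwBar, dzBar]) ∧
    AeppliVia 2 2 (fun g : SmoothT2 => term g.1 ![dw, dz, dwBar, dzBar]) := by
  have hZ := ker_del_comp_delBar
  have hB := range_del_sup_range_delBar
  refine ⟨?_, ?_, ?_, ?_, ?_, ?_, ?_, ?_, ?_⟩
  · exact represents_constT2_range.isoByClasses_gen .one hZ hB (by decide) fun _ =>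
      term_eq_scaled ..
  · exact represents_constT2_top.isoByClasses_gen .z hZ hB (by decide) fun _ => term_eq_scaled ..
  · exact represents_id.isoByClasses_gen .wZ hZ hB (by decide) fun _ => term_eq_scaled ..
  · exact represents_constT2_top.isoByClasses_gen .zBar hZ hB (by decide) fun _ => term_eq_scaled ..
  · exact represents_id.isoByClasses_gen_add_gen represents_constT2_top hZ hB
      fun _ => by simp only [coe_constT2, LinearMap.id_apply]
  · exact represents_constT2_top.isoByClasses_gen .wZZBar hZ hB (by decide) fun _ =>
      term_eq_scaled ..
  · exact represents_id.isoByClasses_gen .wBarZBar hZ hB (by decide) fun _ => term_eq_scaled ..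
  · exact represents_constT2_top.isoByClasses_gen .zWBarZBar hZ hB (by decide) fun _ =>
      term_eq_scaled ..
  · exact represents_id.isoByClasses_gen .top hZ hB (by decide) fun _ => term_eq_scaled ..

end Tables

/-! ### Dimensions, duality and transverse metrics -/

/-- A polynomial in the character `exp (2πi x)`, as a function of `z = x + iy` on the torus. -/
def polyT2 : Polynomial ℂ →ₗ[ℂ] SmoothT2 where
  toFun p := ⟨fun z => p.eval (torusChar ![1, 0] z), by
    have hchar : ContDiff ℝ ∞ (torusChar ![1, 0]) := (freq ![1, 0]).contDiff.cexp
    have hpoly : ContDiff ℝ ∞ fun z : ℂ => p.eval z := by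
      simpa using (p.contDiff_aeval (R := ℂ) (𝕜 := ℂ) ∞).restrict_scalars ℝ
    exact hpoly.comp hchar, fun m n z => congrArg (p.eval ·) (torusChar_add_gauss _ m n z)⟩
  map_add' p q := by ext z; exact Polynomial.eval_add
  map_smul' c p := by ext z; exact Polynomial.eval_smul ..

lemma injOn_torusChar_ofReal :
    Set.InjOn (fun x : ℝ => torusChar ![1, 0] (x : ℂ)) (Set.Ico 0 1) := by
  intro x hx y hy hxy
  simp only [torusChar, freq_apply, Complex.exp_eq_exp_iff_exists_int] at hxy
  obtain ⟨n, hn⟩ := hxy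
  have hsub : (x : ℂ) = y + n := by
    apply mul_left_cancel₀ Complex.two_pi_I_ne_zero
    simp only [Matrix.cons_val_zero, Matrix.cons_val_one, Int.cast_one, Int.cast_zero,
      Complex.ofReal_re, Complex.ofReal_im, Complex.ofReal_zero] at hn
    linear_combination hn
  have hxyn : x = y + n := by exact_mod_cast hsub
  have hn₁ : -1 < n := by exact_mod_cast show (-1 : ℝ) < n by linarith [hx.1, hy.2]
  have hn₂ : n < 1 := by exact_mod_cast show (n : ℝ) < 1 by linarith [hx.2, hy.1]
  obtain rfl : n = 0 := by lia
  simpa using hxyn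

lemma polyT2_injective : Function.Injective polyT2 := by
  rw [← LinearMap.ker_eq_bot, LinearMap.ker_eq_bot']
  intro p hp
  refine p.eq_zero_of_infinite_isRoot ?_
  refine Set.infinite_of_injOn_mapsTo injOn_torusChar_ofReal (fun x _ => ?_)
    (Set.Ico_infinite one_pos)
  exact congrFun (congrArg Subtype.val hp) (x : ℂ)

lemma not_finite_smoothT2 : ¬ FiniteDimensional ℂ SmoothT2 := fun _ =>
  Polynomial.not_finite (Module.Finite.of_injective polyT2 polyT2_injective)

lemma not_finite_smoothT2_prod : ¬ FiniteDimensional ℂ (SmoothT2 × ℂ) := fun _ =>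
  not_finite_smoothT2 (Module.Finite.of_surjective (LinearMap.fst ℂ SmoothT2 ℂ)
    LinearMap.fst_surjective)

lemma IsoByClasses.finite_iff {X : Type} [AddCommGroup X] [Module ℂ X]
    {K I : Submodule ℂ basicForms} {θ : X → RawForm} (h : IsoByClasses K I θ) :
    FiniteDimensional ℂ (QuotBy K I) ↔ FiniteDimensional ℂ X := by
  obtain ⟨e, -⟩ := h
  exact ⟨fun _ => Module.Finite.equiv e.symm, fun _ => Module.Finite.equiv e⟩

lemma IsoByClasses.finite {X : Type} [AddCommGroup X] [Module ℂ X] [FiniteDimensional ℂ X]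
    {K I : Submodule ℂ basicForms} {θ : X → RawForm} (h : IsoByClasses K I θ) :
    FiniteDimensional ℂ (QuotBy K I) :=
  h.finite_iff.2 inferInstance

lemma finite_dolbeault_iff {p q : ℕ} (hp : p ≤ 2) (hq : q ≤ 2) :
    FiniteDimensional ℂ (Dolbeault p q) ↔ (p, q) ≠ (0, 2) ∧ (p, q) ≠ (2, 2) := by
  obtain ⟨h00, h10, h20, h01, h11, h21, h02, h12, h22⟩ := dolbeault_table
  interval_cases p <;> interval_cases q
  · exact iff_of_true h00.finite (by decide)
  · exact iff_of_true h01.finite (by decide)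
  · exact iff_of_false (mt h02.finite_iff.1 not_finite_smoothT2) (by decide)
  · exact iff_of_true h10.finite (by decide)
  · exact iff_of_true h11.finite (by decide)
  · exact iff_of_true h12.finite (by decide)
  · exact iff_of_true h20.finite (by decide)
  · exact iff_of_true h21.finite (by decide)
  · exact iff_of_false (mt h22.finite_iff.1 not_finite_smoothT2) (by decide)

lemma finite_bottChern_iff {p q : ℕ} (hp : p ≤ 2) (hq : q ≤ 2) :
    FiniteDimensional ℂ (BottChern p q) ↔ p + q ≤ 2 := by
  obtain ⟨h00, h10, h20, h01, h11, h21, h02, h12, h22⟩ := bottChern_table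
  interval_cases p <;> interval_cases q
  · exact iff_of_true h00.finite (by decide)
  · exact iff_of_true h01.finite (by decide)
  · exact iff_of_true h02.finite (by decide)
  · exact iff_of_true h10.finite (by decide)
  · exact iff_of_true h11.finite (by decide)
  · exact iff_of_false (mt h12.finite_iff.1 not_finite_smoothT2) (by decide)
  · exact iff_of_true h20.finite (by decide)
  · exact iff_of_false (mt h21.finite_iff.1 not_finite_smoothT2) (by decide)
  · exact iff_of_false (mt h22.finite_iff.1 not_finite_smoothT2) (by decide)

lemma finite_aeppli_iff {p q : ℕ} (hp : p ≤ 2) (hq : q ≤ 2) :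
    FiniteDimensional ℂ (Aeppli p q) ↔ p + q ≠ 2 ∧ p + q ≠ 4 := by
  obtain ⟨h00, h10, h20, h01, h11, h21, h02, h12, h22⟩ := aeppli_table
  interval_cases p <;> interval_cases q
  · exact iff_of_true h00.finite (by decide)
  · exact iff_of_true h01.finite (by decide)
  · exact iff_of_false (mt h02.finite_iff.1 not_finite_smoothT2) (by decide)
  · exact iff_of_true h10.finite (by decide)
  · exact iff_of_false (mt h11.finite_iff.1 not_finite_smoothT2_prod) (by decide)
  · exact iff_of_true h12.finite (by decide)
  · exact iff_of_false (mt h20.finite_iff.1 not_finite_smoothT2) (by decide)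
  · exact iff_of_true h21.finite (by decide)
  · exact iff_of_false (mt h22.finite_iff.1 not_finite_smoothT2) (by decide)

section RealEquiv

variable {V W : Type*} [AddCommGroup V] [AddCommGroup W] [Module ℂ V] [Module ℂ W] [Module ℝ V]
  [Module ℝ W] [IsScalarTower ℝ ℂ V] [IsScalarTower ℝ ℂ W]

lemma finite_of_real_equiv (e : V ≃ₗ[ℝ] W) [FiniteDimensional ℂ V] : FiniteDimensional ℂ W := by
  have : Module.Finite ℝ V := Module.Finite.trans ℂ V
  have : Module.Finite ℝ W := Module.Finite.equiv e
  exact Module.Finite.of_restrictScalars_finite ℝ ℂ W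

lemma not_nonempty_real_equiv (h : ¬(FiniteDimensional ℂ V ↔ FiniteDimensional ℂ W)) :
    ¬ Nonempty (V ≃ₗ[ℝ] W) :=
  fun ⟨e⟩ => h ⟨fun _ => finite_of_real_equiv e, fun _ => finite_of_real_equiv e.symm⟩

end RealEquiv

lemma not_nonempty_real_equiv_dual {V W : Type*} [AddCommGroup V] [AddCommGroup W] [Module ℂ V]
    [Module ℂ W] [Module ℝ V] [IsScalarTower ℝ ℂ V]
    (h : ¬(FiniteDimensional ℂ V ↔ FiniteDimensional ℂ W)) :
    ¬ Nonempty (V ≃ₗ[ℝ] Module.Dual ℂ W) :=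
  not_nonempty_real_equiv fun hfin => h (hfin.trans (Module.finite_dual_iff ℂ))

lemma not_real_equiv_bottChern_aeppli {p q : ℕ} (hp : p ≤ 2) (hq : q ≤ 2) (h₁₀ : (p, q) ≠ (1, 0))
    (h₀₁ : (p, q) ≠ (0, 1)) : ¬ Nonempty (BottChern p q ≃ₗ[ℝ] Aeppli (2 - p) (2 - q)) := by
  refine not_nonempty_real_equiv ?_
  rw [finite_bottChern_iff hp hq, finite_aeppli_iff (Nat.sub_le 2 p) (Nat.sub_le 2 q)]
  simp only [ne_eq, Prod.mk.injEq] at h₁₀ h₀₁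
  lia

lemma not_finite_dolbeault_iff {p q : ℕ} (hp : p ≤ 2) (hq : q ≤ 2)
    (h : p = q ∧ p ≠ 1 ∨ (p, q) = (2, 0) ∨ (p, q) = (0, 2)) :
    ¬(FiniteDimensional ℂ (Dolbeault p q) ↔
      FiniteDimensional ℂ (Dolbeault (2 - p) (2 - q))) := by
  rw [finite_dolbeault_iff hp hq, finite_dolbeault_iff (Nat.sub_le 2 p) (Nat.sub_le 2 q)]
  simp only [ne_eq, Prod.mk.injEq] at h ⊢
  lia

lemma not_exists_isTransverseMetric : ¬ ∃ g, IsTransverseMetric g := by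
  rintro ⟨g, hg⟩
  have hinv := hg.invariant 0 (0, 1) (1, 0)
  have hshear : shear ((0, 1) : ℂ × ℂ) = (0, 1) + (1, 0) := by simp [shear]
  have hfix : shear ((1, 0) : ℂ × ℂ) = (1, 0) := by simp [shear]
  rw [map_zero, hshear, hfix, map_add, add_apply, add_eq_left] at hinv
  exact (hg.pos 0 (1, 0) (by simp)).ne' hinv

end TorusSuspension

end

theorem mainTheorem7 :
    -- Dolbeault table
    (DolbeaultVia 0 0 (fun a : ℂ => term (fun _ => a) ![]) ∧
      DolbeaultVia 1 0 (fun a : ℂ => term (fun _ => a) ![dz]) ∧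
      DolbeaultVia 2 0 (fun a : ℂ => term (fun _ => a) ![dw, dz]) ∧
      DolbeaultVia 0 1 (fun a : ℂ => term (fun _ => a) ![dzBar]) ∧
      DolbeaultVia 1 1
        (fun a : ℂ × ℂ => mixed (fun _ => a.1) + term (fun _ => a.2) ![dz, dzBar]) ∧
      DolbeaultVia 2 1 (fun a : ℂ => term (fun _ => a) ![dw, dz, dzBar]) ∧
      DolbeaultVia 0 2 (fun g : SmoothT2 => term g.1 ![dwBar, dzBar]) ∧
      DolbeaultVia 1 2 (fun a : ℂ => term (fun _ => a) ![dz, dwBar, dzBar]) ∧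
      DolbeaultVia 2 2 (fun g : SmoothT2 => term g.1 ![dw, dz, dwBar, dzBar])) ∧
    -- Bott-Chern table
    (BottChernVia 0 0 (fun a : ℂ => term (fun _ => a) ![]) ∧
      BottChernVia 1 0 (fun a : ℂ => term (fun _ => a) ![dz]) ∧
      BottChernVia 2 0 (fun a : ℂ => term (fun _ => a) ![dw, dz]) ∧
      BottChernVia 0 1 (fun a : ℂ => term (fun _ => a) ![dzBar]) ∧
      BottChernVia 1 1
        (fun a : ℂ × ℂ => mixed (fun _ => a.1) + term (fun _ => a.2) ![dz, dzBar]) ∧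
      BottChernVia 2 1 (fun g : SmoothT2 => term g.1 ![dw, dz, dzBar]) ∧
      BottChernVia 0 2 (fun a : ℂ => term (fun _ => a) ![dwBar, dzBar]) ∧
      BottChernVia 1 2 (fun g : SmoothT2 => term g.1 ![dz, dwBar, dzBar]) ∧
      BottChernVia 2 2 (fun g : SmoothT2 => term g.1 ![dw, dz, dwBar, dzBar])) ∧
    -- Aeppli table
    (AeppliVia 0 0 (fun a : ℂ => term (fun _ => a) ![]) ∧
      AeppliVia 1 0 (fun a : ℂ => term (fun _ => a) ![dz]) ∧
      AeppliVia 2 0 (fun g : SmoothT2 => term g.1 ![dw, dz]) ∧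
      AeppliVia 0 1 (fun a : ℂ => term (fun _ => a) ![dzBar]) ∧
      AeppliVia 1 1
        (fun a : SmoothT2 × ℂ => mixed a.1.1 + term (fun _ => a.2) ![dz, dzBar]) ∧
      AeppliVia 2 1 (fun a : ℂ => term (fun _ => a) ![dw, dz, dzBar]) ∧
      AeppliVia 0 2 (fun g : SmoothT2 => term g.1 ![dwBar, dzBar]) ∧
      AeppliVia 1 2 (fun a : ℂ => term (fun _ => a) ![dz, dwBar, dzBar]) ∧
      AeppliVia 2 2 (fun g : SmoothT2 => term g.1 ![dw, dz, dwBar, dzBar])) ∧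
    -- infinite and finite dimension
    (¬ FiniteDimensional ℂ (Aeppli 2 0) ∧ ¬ FiniteDimensional ℂ (Aeppli 1 1) ∧
      ¬ FiniteDimensional ℂ (Aeppli 0 2) ∧ ¬ FiniteDimensional ℂ (Aeppli 2 2) ∧
      FiniteDimensional ℂ (Dolbeault 1 1)) ∧
    -- no invariant transverse Riemannian metric
    (¬ ∃ g, IsTransverseMetric g) ∧
    -- failure of the duality between Bott-Chern and Aeppli cohomology
    (∀ p ≤ 2, ∀ q ≤ 2, (p, q) ≠ (1, 0) → (p, q) ≠ (0, 1) →
      ¬ Nonempty (BottChern p q ≃ₗ[ℝ] Aeppli (2 - p) (2 - q))) ∧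
    -- failure of Serre duality
    (∀ p ≤ 2, ∀ q ≤ 2, p = q ∧ p ≠ 1 ∨ (p, q) = (2, 0) ∨ (p, q) = (0, 2) →
      ¬ Nonempty (Dolbeault p q ≃ₗ[ℝ] Module.Dual ℂ (Dolbeault (2 - p) (2 - q))) ∧
      ¬ Nonempty (Dolbeault p q ≃ₗ[ℝ] Dolbeault (2 - p) (2 - q))) := by
  refine ⟨dolbeault_table, bottChern_table, aeppli_table, ⟨?_, ?_, ?_, ?_, ?_⟩,
    not_exists_isTransverseMetric,
    fun p hp q hq h₁₀ h₀₁ => not_real_equiv_bottChern_aeppli hp hq h₁₀ h₀₁,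
    fun p hp q hq h => ⟨not_nonempty_real_equiv_dual (not_finite_dolbeault_iff hp hq h),
      not_nonempty_real_equiv (not_finite_dolbeault_iff hp hq h)⟩⟩
  · exact (finite_aeppli_iff (by decide) (by decide)).not.2 (by decide)
  · exact (finite_aeppli_iff (by decide) (by decide)).not.2 (by decide)
  · exact (finite_aeppli_iff (by decide) (by decide)).not.2 (by decide)
  · exact (finite_aeppli_iff (by decide) (by decide)).not.2 (by decide)
  · exact (finite_dolbeault_iff (by decide) (by decide)).2 (by decide)
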